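/- Conventions. A rational function $A=p/q\in\mathbb C(z)$ (with $p,q$ coprime polynomials) has degree $\max(\deg p,\deg q)$ and is regarded as a self-map of the Riemann sphere $\mathbb P^1$. Let $A$ have degree at least two. It is called tame if the algebraic curve $A(x)-A(y)=0$, that is, the curve $p(x)q(y)-p(y)q(x)=0$, has no irreducible factor of genus zero or one distinct from the diagonal $x-y=0$; otherwise $A$ is called wild. Here the genus of an irreducible curve is the genus of its desingularization, and the genus of a compact Riemann surface is the dimension of its space of holomorphic $1$-forms. A (possibly branched) Galois covering $\Psi:S\to\mathbb P^1$ of a compact Riemann surface $S$ is a nonconstant holomorphic map such that the group of automorphisms $\sigma$ of $S$ with $\Psi\circ\sigma=\Psi$ acts transitively on every fibre of $\Psi$. A map $f:S\to\mathbb P^1$ is called a rational function in $\Psi$ if $f=R\circ\Psi$ for some rational self-map $R$ of $\mathbb P^1$ (constant maps, including the constant $\infty$, are allowed). Theorem. Let $A$ be a rational function of degree at least two. Assume that there exist a compact (connected) Riemann surface $S$ of genus zero or one, a holomorphic map $U:S\to\mathbb P^1$, and a Galois covering $\Psi:S\to\mathbb P^1$ such that $A\circ U$ is a rational function in $\Psi$,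 but $U$ is not a rational function in $\Psi$. Then $A$ is wild. -/

import Mathlib

open scoped Manifold ContDiff Topology KaehlerDifferential

noncomputable section

namespace TameRational

/-! ### The Riemann sphere as a complex manifold -/

/-- The Riemann sphere `ℂ ∪ {∞}`. -/
abbrev RiemannSphere : Type := OnePoint ℂ

/-- The inversion `z ↦ 1 / z` of the Riemann sphere, exchanging `0` and `∞`. -/
def sphereInv : RiemannSphere → RiemannSphere
  | OnePoint.infty => ((0 : ℂ) : RiemannSphere)
  | OnePoint.some z => if z = 0 then OnePoint.infty else ((z⁻¹ : ℂ) : RiemannSphere)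

@[simp] theorem sphereInv_infty : sphereInv OnePoint.infty = ((0 : ℂ) : RiemannSphere) := rfl

theorem sphereInv_coe (z : ℂ) : sphereInv (z : RiemannSphere) =
    if z = 0 then OnePoint.infty else ((z⁻¹ : ℂ) : RiemannSphere) := rfl

@[simp] theorem sphereInv_zero : sphereInv ((0 : ℂ) : RiemannSphere) = OnePoint.infty := by
  simp [sphereInv_coe]

theorem sphereInv_coe_ne {z : ℂ} (hz : z ≠ 0) :
    sphereInv (z : RiemannSphere) = ((z⁻¹ : ℂ) : RiemannSphere) := by
  simp [sphereInv_coe, hz]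

theorem sphereInv_sphereInv (p : RiemannSphere) : sphereInv (sphereInv p) = p := by
  induction p using OnePoint.rec with
  | infty => simp
  | coe z =>
    by_cases hz : z = 0
    · simp [hz]
    · rw [sphereInv_coe_ne hz, sphereInv_coe_ne (inv_ne_zero hz), inv_inv]

theorem continuous_sphereInv : Continuous sphereInv := by
  rw [continuous_iff_continuousAt]
  intro p
  induction p using OnePoint.rec with
  | infty =>
    rw [OnePoint.continuousAt_infty']
    simp only [sphereInv_infty]
    have h1 : Filter.Tendsto (fun z : ℂ => z⁻¹) (Filter.coclosedCompact ℂ) (𝓝 0) := by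
      rw [Filter.coclosedCompact_eq_cocompact, ← Metric.cobounded_eq_cocompact]
      exact Filter.tendsto_inv₀_cobounded
    have h2 := (OnePoint.continuous_coe.tendsto (0 : ℂ)).comp h1
    refine h2.congr' ?_
    have h3 : ∀ᶠ z : ℂ in Filter.coclosedCompact ℂ, z ≠ 0 := by
      rw [Filter.coclosedCompact_eq_cocompact]
      exact (isCompact_singleton (x := (0 : ℂ))).compl_mem_cocompact
    filter_upwards [h3] with z hz
    simp [sphereInv_coe_ne hz]
  | coe z =>
    rw [OnePoint.continuousAt_coe]
    by_cases hz : z = 0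
    · subst hz
      rw [continuousAt_iff_punctured_nhds]
      simp only [Function.comp_apply, sphereInv_zero]
      have h1 : Filter.Tendsto (fun z : ℂ => z⁻¹) (𝓝[≠] 0) (Filter.coclosedCompact ℂ) := by
        rw [Filter.coclosedCompact_eq_cocompact, ← Metric.cobounded_eq_cocompact]
        exact Filter.tendsto_inv₀_nhdsNE_zero
      have h2 : Filter.Tendsto (fun z : ℂ => (z : RiemannSphere)) (Filter.coclosedCompact ℂ)
          (𝓝 OnePoint.infty) := OnePoint.tendsto_coe_infty
      refine (h2.comp h1).congr' ?_
      filter_upwards [self_mem_nhdsWithin] with z hz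
      simp [sphereInv_coe_ne hz]
    · have h1 : ContinuousAt (fun z : ℂ => ((z⁻¹ : ℂ) : RiemannSphere)) z :=
        OnePoint.continuous_coe.continuousAt.comp (continuousAt_inv₀ hz)
      refine h1.congr ?_
      filter_upwards [isOpen_ne.mem_nhds hz] with w hw
      simp [sphereInv_coe_ne hw]

/-- The inversion as a homeomorphism of the Riemann sphere. -/
def sphereInvHomeomorph : RiemannSphere ≃ₜ RiemannSphere where
  toFun := sphereInv
  invFun := sphereInv
  left_inv := sphereInv_sphereInv
  right_inv := sphereInv_sphereInv
  continuous_toFun := continuous_sphereInv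
  continuous_invFun := continuous_sphereInv

/-- The affine chart `z` on `ℂ`. -/
def chartZero : OpenPartialHomeomorph RiemannSphere ℂ :=
  (OnePoint.isOpenEmbedding_coe.toOpenPartialHomeomorph ((↑) : ℂ → RiemannSphere)).symm

/-- The chart `1 / z` on the complement of `0`. -/
def chartInfty : OpenPartialHomeomorph RiemannSphere ℂ :=
  sphereInvHomeomorph.transOpenPartialHomeomorph chartZero

open Classical in
instance : ChartedSpace ℂ RiemannSphere where
  atlas := {chartZero, chartInfty}
  chartAt p := if p = OnePoint.infty then chartInfty else chartZero
  mem_chart_source p := by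
    induction p using OnePoint.rec with
    | infty =>
      simp only [if_true]
      exact ⟨0, trivial, rfl⟩
    | coe z =>
      simp only [OnePoint.coe_ne_infty, if_false]
      exact ⟨z, trivial, rfl⟩
  chart_mem_atlas p := by
    split_ifs <;> simp

theorem chartZero_symm (z : ℂ) : chartZero.symm z = (z : RiemannSphere) := rfl

theorem chartZero_coe (z : ℂ) : chartZero (z : RiemannSphere) = z :=
  (OnePoint.isOpenEmbedding_coe.toOpenPartialHomeomorph
    ((↑) : ℂ → RiemannSphere)).left_inv (Set.mem_univ z)

theorem infty_notMem_chartZero_source : (OnePoint.infty : RiemannSphere) ∉ chartZero.source := by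
  rintro ⟨z, -, hz⟩
  exact OnePoint.coe_ne_infty z hz

theorem chartInfty_apply (p : RiemannSphere) : chartInfty p = chartZero (sphereInv p) := rfl

theorem chartInfty_symm (z : ℂ) : chartInfty.symm z = sphereInv (z : RiemannSphere) := rfl

theorem mem_chartInfty_source (p : RiemannSphere) :
    p ∈ chartInfty.source ↔ sphereInv p ∈ chartZero.source := Iff.rfl

instance : IsManifold 𝓘(ℂ) ω RiemannSphere := by
  apply isManifold_of_contDiffOn
  have key : ∀ e e' : OpenPartialHomeomorph RiemannSphere ℂ,
      (∀ z : ℂ, z ∈ (e.symm ≫ₕ e').source → z ≠ 0 ∧ e' (e.symm z) = z⁻¹) →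
      ContDiffOn ℂ ω (𝓘(ℂ) ∘ e.symm ≫ₕ e' ∘ 𝓘(ℂ).symm)
        (𝓘(ℂ).symm ⁻¹' (e.symm ≫ₕ e').source ∩ Set.range 𝓘(ℂ)) := by
    intro e e' h
    refine ContDiffOn.congr (f := fun z : ℂ => z⁻¹) ?_ (fun z hz => (h z hz.1).2)
    exact fun z hz => (contDiffAt_inv ℂ (h z hz.1).1).contDiffWithinAt
  have keyId : ∀ e : OpenPartialHomeomorph RiemannSphere ℂ,
      ContDiffOn ℂ ω (𝓘(ℂ) ∘ e.symm ≫ₕ e ∘ 𝓘(ℂ).symm)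
        (𝓘(ℂ).symm ⁻¹' (e.symm ≫ₕ e).source ∩ Set.range 𝓘(ℂ)) := by
    intro e
    refine ContDiffOn.congr (f := fun z : ℂ => z) contDiffOn_id (fun z hz => ?_)
    exact e.right_inv (show z ∈ e.target from hz.1.1)
  have hne : ∀ z : ℂ, sphereInv (z : RiemannSphere) ∈ chartZero.source → z ≠ 0 := by
    rintro z hz rfl
    rw [sphereInv_zero] at hz
    exact infty_notMem_chartZero_source hz
  rintro e e' (rfl | rfl) (rfl | rfl)
  · exact keyId _
  · refine key _ _ fun z hz => ?_
    have hz0 : z ≠ 0 := hne z hz.2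
    refine ⟨hz0, ?_⟩
    rw [chartInfty_apply, chartZero_symm, sphereInv_coe_ne hz0, chartZero_coe]
  · refine key _ _ fun z hz => ?_
    have hz0 : z ≠ 0 := hne z hz.2
    refine ⟨hz0, ?_⟩
    rw [chartInfty_symm, sphereInv_coe_ne hz0, chartZero_coe]
  · exact keyId _

/-! ### Rational functions as self-maps of the Riemann sphere -/

/-- The degree of a rational function `A = p / q` in lowest terms: `max (deg p) (deg q)`. -/
def ratDegree (A : RatFunc ℂ) : ℕ := max A.num.natDegree A.denom.natDegree

open Classical in
/-- The self-map of the Riemann sphere induced by a rational function `A = p / q` in lowest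
terms: it sends the zeros of `q` to `∞`, and its value at `∞` is the limit of `A z` as
`z → ∞`. -/
def ratMap (A : RatFunc ℂ) : RiemannSphere → RiemannSphere
  | OnePoint.infty =>
      if A.denom.natDegree < A.num.natDegree then OnePoint.infty
      else ((A.num.coeff A.denom.natDegree / A.denom.leadingCoeff : ℂ) : RiemannSphere)
  | OnePoint.some z =>
      if A.denom.eval z = 0 then OnePoint.infty
      else ((A.num.eval z / A.denom.eval z : ℂ) : RiemannSphere)

/-- `f` is a rational function in `g`: `f = R ∘ g` for a rational self-map `R` of the Riemann
sphere, where `R` is given by an element of `ℂ(z)` or is the constant `∞`. -/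
def IsRationalIn {S : Type*} (f g : S → RiemannSphere) : Prop :=
  (∃ R : RatFunc ℂ, f = ratMap R ∘ g) ∨ f = fun _ => OnePoint.infty

/-! ### Compact Riemann surfaces -/

/-- The complex vector space of holomorphic `1`-forms on a complex-analytic curve `S`, i.e. of
holomorphic sections of its cotangent bundle. -/
abbrev HolomorphicOneForm (S : Type*) [TopologicalSpace S] [ChartedSpace ℂ S]
    [IsManifold 𝓘(ℂ) ω S] : Type _ :=
  haveI : IsManifold 𝓘(ℂ) 1 S := IsManifold.of_le (n := ω) le_top
  Cₛ^ω⟮𝓘(ℂ); (ℂ →L[ℂ] ℂ), fun x : S => TangentSpace 𝓘(ℂ) x →L[ℂ] Bundle.Trivial S ℂ x⟯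

/-- The genus of a compact Riemann surface: the dimension of its space of holomorphic
`1`-forms. -/
def surfaceGenus (S : Type*) [TopologicalSpace S] [ChartedSpace ℂ S]
    [IsManifold 𝓘(ℂ) ω S] : Cardinal :=
  Module.rank ℂ (HolomorphicOneForm S)

/-- A (possibly branched) Galois covering `Ψ : S → ℙ¹`: a nonconstant holomorphic map such that
the group of biholomorphic automorphisms `σ` of `S` with `Ψ ∘ σ = Ψ` acts transitively on every
fibre of `Ψ`. -/
structure IsGaloisCovering {S : Type*} [TopologicalSpace S] [ChartedSpace ℂ S]
    (Ψ : S → RiemannSphere) : Prop where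
  holomorphic : MDifferentiable 𝓘(ℂ) 𝓘(ℂ) Ψ
  nonconstant : ¬ ∃ c, ∀ x, Ψ x = c
  transitive : ∀ x y, Ψ x = Ψ y →
    ∃ σ : S ≃ₘ^ω⟮𝓘(ℂ), 𝓘(ℂ)⟯ S, Ψ ∘ σ = Ψ ∧ σ x = y

/-! ### The genus of a plane algebraic curve -/

/-- The differentials of the first kind of a field `K` of algebraic functions over `ℂ`: the Kähler
differentials `η` of `K / ℂ` that are regular at every place, i.e. for every valuation ring `O` of
`K` containing `ℂ`, `η` is a finite sum of terms `a db` with `a, b ∈ O`. -/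
def firstKindDifferentials (K : Type*) [Field K] [Algebra ℂ K] : Submodule ℂ (Ω[K⁄ℂ]) where
  carrier := {η | ∀ O : ValuationSubring K, (∀ c : ℂ, algebraMap ℂ K c ∈ O) →
    η ∈ Submodule.span O (KaehlerDifferential.D ℂ K '' (O : Set K))}
  zero_mem' := fun _ _ => Submodule.zero_mem _
  add_mem' := fun h₁ h₂ O hO => Submodule.add_mem _ (h₁ O hO) (h₂ O hO)
  smul_mem' := fun c η h O hO => by
    have h1 := Submodule.smul_mem _ (⟨algebraMap ℂ K c, hO c⟩ : O) (h O hO)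
    have h2 : (⟨algebraMap ℂ K c, hO c⟩ : O) • η = c • η := algebraMap_smul K c η
    rwa [h2] at h1

/-- The genus of a field of algebraic functions over `ℂ`, i.e. of its smooth projective model: the
dimension of the space of differentials of the first kind. -/
def functionFieldGenus (K : Type*) [Field K] [Algebra ℂ K] : Cardinal :=
  Module.rank ℂ (firstKindDifferentials K)

theorem span_singleton_isPrime {F : MvPolynomial (Fin 2) ℂ} (hF : Irreducible F) :
    (Ideal.span {F}).IsPrime :=
  (Ideal.span_singleton_prime hF.ne_zero).2 hF.prime

/-- The genus of (the desingularization of) the irreducible plane curve `F(x, y) = 0`: the genus of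
its function field `Frac (ℂ[x, y] / (F))`. -/
def planeCurveGenus (F : MvPolynomial (Fin 2) ℂ) (hF : Irreducible F) : Cardinal :=
  haveI := span_singleton_isPrime hF
  functionFieldGenus (FractionRing (MvPolynomial (Fin 2) ℂ ⧸ Ideal.span {F}))

/-! ### Tame and wild rational functions -/

/-- The polynomial `p(x) q(y) - p(y) q(x)` defining the algebraic curve `A(x) - A(y) = 0`, where
`A = p / q` in lowest terms. -/
def differenceCurve (A : RatFunc ℂ) : MvPolynomial (Fin 2) ℂ :=
  Polynomial.aeval (MvPolynomial.X 0) A.num * Polynomial.aeval (MvPolynomial.X 1) A.denom -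
    Polynomial.aeval (MvPolynomial.X 1) A.num * Polynomial.aeval (MvPolynomial.X 0) A.denom

/-- `A` is tame if the algebraic curve `A(x) - A(y) = 0` has no irreducible factors of genus zero or
one distinct from the diagonal `x - y = 0`. -/
def IsTame (A : RatFunc ℂ) : Prop :=
  ¬ ∃ (F : MvPolynomial (Fin 2) ℂ) (hF : Irreducible F), F ∣ differenceCurve A ∧
    ¬ Associated F (MvPolynomial.X 0 - MvPolynomial.X 1) ∧
    (planeCurveGenus F hF = 0 ∨ planeCurveGenus F hF = 1)

/-- `A` is wild if it is not tame. -/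
def IsWild (A : RatFunc ℂ) : Prop := ¬ IsTame A

end TameRational

end

open TameRational

noncomputable section

namespace TameRational

open Filter

/-! ### Codiscrete sets and meromorphic functions on a complex curve -/

/-! Write `V = U ∘ σ` for an automorphism `σ` of `S` over `Ψ`. If `V = U` for every such `σ`, then
transitivity makes `U` constant on the fibres of `Ψ`, so `U = R ∘ Ψ` for some self-map `R` of the
sphere. This `R` is continuous because `Ψ` is open and surjective, holomorphic because singularities
at critical values are removable, and therefore rational (`isRationalIn_of_factors`,
`exists_eq_ratMap_of_mdifferentiable`). Hence some `σ` gives `V ≠ U`, while `A ∘ V = A ∘ U` because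
`A ∘ U` factors through `Ψ`.

The pair `(U, V)` now parametrizes part of the curve `A(x) = A(y)` (`isWild_of_ratMap_comp_eq`). The
polynomial relations between the coordinates of `U` and `V` form a prime ideal containing
`differenceCurve A`, hence an irreducible factor `F` of it, and `F` is not the diagonal because `U`
and `V` agree only on a discrete set.

It remains to bound the genus of `F = 0` by that of `S` (`planeCurveGenus_le`). The relation ideal
is exactly `(F)`, so the function field of the curve embeds into the meromorphic functions on `S`,
and Kähler differentials pull back to meromorphic forms. Each point of `S` defines a valuation ring
of the function field, so a differential regular at all places pulls back to a holomorphic form. The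
pullback is injective because the differentials form a space spanned by `dx` or `dy`, and neither
coordinate is constant on `S`.

Meromorphic functions and forms are handled as germs along the codiscrete filter, that is, up to
discrete sets. -/

theorem eventually_codiscrete_iff {X : Type*} [TopologicalSpace X] {p : X → Prop} :
    (∀ᶠ x in codiscrete X, p x) ↔ ∀ s, ∀ᶠ x in 𝓝[≠] s, p x := by
  simp only [Filter.Eventually, mem_codiscrete, disjoint_principal_right, compl_compl]

/-- The points around which `p` holds form an open set, and so do the points around which it fails;
connectedness leaves only one of them. This is the common source of the identity principles below.
-/
theorem eventually_codiscrete_or_of_forall {X : Type*} [TopologicalSpace X] [T1Space X]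
    [PreconnectedSpace X] {p : X → Prop} (hd : ∀ s : X, (𝓝[≠] s).NeBot)
    (h : ∀ s, (∀ᶠ x in 𝓝[≠] s, p x) ∨ ∀ᶠ x in 𝓝[≠] s, ¬ p x) :
    (∀ᶠ x in codiscrete X, p x) ∨ ∀ᶠ x in codiscrete X, ¬ p x := by
  have hopen : ∀ q : X → Prop, IsOpen {s | ∀ᶠ x in 𝓝[≠] s, q x} := by
    intro q
    rw [isOpen_iff_mem_nhds]
    intro s hs
    have h1 : ∀ᶠ y in 𝓝[≠] s, ∀ᶠ x in 𝓝 y, q x := eventually_nhdsNE_eventually_nhds_iff.2 hs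
    rw [eventually_nhdsWithin_iff] at h1
    filter_upwards [h1] with y hy
    by_cases hys : y = s
    · rw [hys]; exact hs
    · exact (hy hys).filter_mono nhdsWithin_le_nhds
  have hcl : IsClopen {s : X | ∀ᶠ x in 𝓝[≠] s, p x} := by
    refine ⟨⟨?_⟩, hopen p⟩
    convert! hopen (fun x => ¬ p x) using 1
    ext s
    simp only [Set.mem_compl_iff, Set.mem_ofPred_eq]
    constructor
    · exact fun hs => (h s).resolve_left hs
    · intro h1 h2
      have := hd s
      obtain ⟨x, hx, hx'⟩ := (h1.and h2).exists
      exact hx hx'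
  rcases isClopen_iff.1 hcl with he | hu
  · right
    rw [eventually_codiscrete_iff]
    exact fun s => (h s).resolve_left fun hs => (he ▸ hs : s ∈ (∅ : Set X))
  · left
    rw [eventually_codiscrete_iff]
    exact fun s => (hu ▸ Set.mem_univ s : s ∈ {s : X | ∀ᶠ x in 𝓝[≠] s, p x})

section Charts

variable {S : Type*} [TopologicalSpace S] [ChartedSpace ℂ S]

theorem map_chartAt_nhdsNE (s : S) :
    map (chartAt ℂ s) (𝓝[≠] s) = 𝓝[≠] (chartAt ℂ s s) := by
  rw [← (chartAt ℂ s).map_nhdsWithin_preimage_eq (mem_chart_source ℂ s)]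
  congr 1
  rw [nhdsWithin_eq_iff_eventuallyEq]
  filter_upwards [chart_source_mem_nhds ℂ s] with x hx
  exact propext (not_congr ((chartAt ℂ s).injOn.eq_iff hx (mem_chart_source ℂ s)).symm)

theorem eventually_nhdsNE_chartAt_iff {s : S} {p : S → Prop} :
    (∀ᶠ z in 𝓝[≠] (chartAt ℂ s s), p ((chartAt ℂ s).symm z)) ↔ ∀ᶠ x in 𝓝[≠] s, p x := by
  rw [← map_chartAt_nhdsNE, eventually_map]
  refine eventually_congr ?_
  filter_upwards [nhdsWithin_le_nhds (chart_source_mem_nhds ℂ s)] with x hx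
  rw [(chartAt ℂ s).left_inv hx]

theorem eventually_nhds_chartAt_iff {s : S} {p : S → Prop} :
    (∀ᶠ z in 𝓝 (chartAt ℂ s s), p ((chartAt ℂ s).symm z)) ↔ ∀ᶠ x in 𝓝 s, p x := by
  rw [← (chartAt ℂ s).map_nhds_eq (mem_chart_source ℂ s), eventually_map]
  refine eventually_congr ?_
  filter_upwards [chart_source_mem_nhds ℂ s] with x hx
  rw [(chartAt ℂ s).left_inv hx]

theorem nhdsNE_neBot (s : S) : (𝓝[≠] s).NeBot := by
  rw [← Filter.map_neBot_iff (chartAt ℂ s), map_chartAt_nhdsNE]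
  infer_instance

theorem codiscrete_neBot [Nonempty S] : (codiscrete S).NeBot := by
  obtain ⟨s⟩ := ‹Nonempty S›
  have := nhdsNE_neBot s
  refine ⟨fun h => this.ne ?_⟩
  have h1 : ∀ᶠ _ in codiscrete S, False := h ▸ eventually_bot
  exact eventually_false_iff_eq_bot.1 (eventually_codiscrete_iff.1 h1 s)

/-- A function on a complex curve is meromorphic if it is so in the preferred chart of every
point. -/
def IsMeromorphic (f : S → ℂ) : Prop :=
  ∀ s, MeromorphicAt (f ∘ (chartAt ℂ s).symm) (chartAt ℂ s s)

namespace IsMeromorphic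

variable {f g : S → ℂ}

theorem const (c : ℂ) : IsMeromorphic (fun _ : S => c) := fun _ => MeromorphicAt.const c _

theorem add (hf : IsMeromorphic f) (hg : IsMeromorphic g) : IsMeromorphic (f + g) :=
  fun s => (hf s).add (hg s)

theorem mul (hf : IsMeromorphic f) (hg : IsMeromorphic g) : IsMeromorphic (f * g) :=
  fun s => (hf s).mul (hg s)

theorem inv (hf : IsMeromorphic f) : IsMeromorphic f⁻¹ := fun s => (hf s).inv

theorem congr (hf : IsMeromorphic f) (h : f =ᶠ[codiscrete S] g) : IsMeromorphic g := fun s =>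
  (hf s).congr (eventually_nhdsNE_chartAt_iff.2 (eventually_codiscrete_iff.1 h s))

theorem aeval {ι : Type*} {v : ι → S → ℂ} (hv : ∀ i, IsMeromorphic (v i))
    (P : MvPolynomial ι ℂ) : IsMeromorphic (MvPolynomial.aeval v P) := by
  induction P using MvPolynomial.induction_on with
  | C a => simpa using! const a
  | add p q hp hq => simpa using hp.add hq
  | mul_X p i hp => simpa using hp.mul (hv i)

theorem eventually_eq_zero_or_ne_zero [T1Space S] [PreconnectedSpace S] (hf : IsMeromorphic f) :
    (∀ᶠ x in codiscrete S, f x = 0) ∨ ∀ᶠ x in codiscrete S, f x ≠ 0 := by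
  refine eventually_codiscrete_or_of_forall nhdsNE_neBot fun s => ?_
  rw [← eventually_nhdsNE_chartAt_iff, ← eventually_nhdsNE_chartAt_iff (p := fun x => ¬ f x = 0)]
  exact (hf s).eventually_eq_zero_or_eventually_ne_zero

end IsMeromorphic

theorem contMDiffAt_iff_analyticAt {f : S → ℂ} {s : S} :
    ContMDiffAt 𝓘(ℂ) 𝓘(ℂ) ω f s ↔
      ContinuousAt f s ∧ AnalyticAt ℂ (f ∘ (chartAt ℂ s).symm) (chartAt ℂ s s) := by
  rw [contMDiffAt_iff]
  simp only [extChartAt, mfld_simps, modelWithCornersSelf_coe, Set.range_id,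
    contDiffWithinAt_omega_iff_analyticWithinAt, analyticWithinAt_univ, chartAt_self_eq]

theorem contMDiffAt_comp_chartAt [IsManifold 𝓘(ℂ) ω S] {s : S} {g : ℂ → ℂ}
    (hg : AnalyticAt ℂ g (chartAt ℂ s s)) :
    ContMDiffAt 𝓘(ℂ) 𝓘(ℂ) ω (g ∘ chartAt ℂ s) s := by
  have h1 : ContMDiffAt 𝓘(ℂ) 𝓘(ℂ) ω (chartAt ℂ s) s :=
    contMDiffAt_of_mem_maximalAtlas (IsManifold.chart_mem_maximalAtlas s) (mem_chart_source ℂ s)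
  exact (hg.contDiffAt.contMDiffAt).comp s h1

/-- Complex differentiability on an open set implies analyticity. This links the `MDifferentiable`
maps of the theorem with the `C^ω` sections that define the genus. -/
theorem ContMDiffAt.of_eventually_mdifferentiableAt [IsManifold 𝓘(ℂ) ω S] {f : S → ℂ} {s : S}
    (hf : ∀ᶠ x in 𝓝 s, MDifferentiableAt 𝓘(ℂ) 𝓘(ℂ) f x) :
    ContMDiffAt 𝓘(ℂ) 𝓘(ℂ) ω f s := by
  have : IsManifold 𝓘(ℂ) 1 S := IsManifold.of_le (n := ω) le_top
  rw [contMDiffAt_iff_analyticAt]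
  refine ⟨hf.self_of_nhds.continuousAt, ?_⟩
  rw [Complex.analyticAt_iff_eventually_differentiableAt]
  filter_upwards [eventually_nhds_chartAt_iff.2 hf,
    (chartAt ℂ s).open_target.mem_nhds (mem_chart_target ℂ s)] with z hz hzt
  have h1 : MDifferentiableAt 𝓘(ℂ) 𝓘(ℂ) (chartAt ℂ s).symm z :=
    mdifferentiableAt_atlas_symm (chart_mem_atlas ℂ s) hzt
  exact (hz.comp z h1).differentiableAt

/-- A function meromorphic at `s` of nonnegative order agrees near `s` with a holomorphic one. -/
theorem exists_contMDiffAt_of_order_nonneg [IsManifold 𝓘(ℂ) ω S] {f : S → ℂ} {s : S}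
    (hf : MeromorphicAt (f ∘ (chartAt ℂ s).symm) (chartAt ℂ s s))
    (h0 : 0 ≤ meromorphicOrderAt (f ∘ (chartAt ℂ s).symm) (chartAt ℂ s s)) :
    ∃ g : S → ℂ, ContMDiffAt 𝓘(ℂ) 𝓘(ℂ) ω g s ∧ f =ᶠ[𝓝[≠] s] g := by
  obtain ⟨g, hg, hfg⟩ := (hf.meromorphicOrderAt_nonneg_iff).1 h0
  refine ⟨g ∘ chartAt ℂ s, contMDiffAt_comp_chartAt hg, ?_⟩
  rw [← map_chartAt_nhdsNE] at hfg
  filter_upwards [eventually_map.1 hfg,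
    nhdsWithin_le_nhds (chart_source_mem_nhds ℂ s)] with x hx hxs
  simpa [(chartAt ℂ s).left_inv hxs] using hx

theorem IsMeromorphic.eventually_mdifferentiableAt [IsManifold 𝓘(ℂ) ω S] [T1Space S] {f : S → ℂ}
    (hf : IsMeromorphic f) : ∀ᶠ x in codiscrete S, MDifferentiableAt 𝓘(ℂ) 𝓘(ℂ) f x := by
  have : IsManifold 𝓘(ℂ) 1 S := IsManifold.of_le (n := ω) le_top
  rw [eventually_codiscrete_iff]
  intro s
  have h1 := (hf s).eventually_analyticAt
  rw [← map_chartAt_nhdsNE] at h1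
  filter_upwards [eventually_map.1 h1,
    nhdsWithin_le_nhds (chart_source_mem_nhds ℂ s)] with x hx hxs
  have h2 : MDifferentiableAt 𝓘(ℂ) 𝓘(ℂ) (chartAt ℂ s) x :=
    mdifferentiableAt_atlas (chart_mem_atlas ℂ s) hxs
  have h3 := (hx.differentiableAt.mdifferentiableAt).comp x h2
  refine h3.congr_of_eventuallyEq ?_
  filter_upwards [(chartAt ℂ s).open_source.mem_nhds hxs] with y hy
  simp [(chartAt ℂ s).left_inv hy]

end Charts

/-! ### Local theory of holomorphic `1`-forms -/

section Forms

variable {S : Type*} [TopologicalSpace S] [ChartedSpace ℂ S] [IsManifold 𝓘(ℂ) ω S]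

/-- A not necessarily continuous field of covectors on a complex curve. -/
abbrev CovectorField (S : Type*) [TopologicalSpace S] [ChartedSpace ℂ S] : Type _ :=
  ∀ x : S, TangentSpace 𝓘(ℂ) x →L[ℂ] Bundle.Trivial S ℂ x

instance isManifold_one : IsManifold 𝓘(ℂ) 1 S := IsManifold.of_le (n := ω) le_top

/-- A covector field is holomorphic at a point. -/
def HolomorphicFormAt (α : CovectorField S) (s : S) : Prop :=
  ContMDiffAt 𝓘(ℂ) (𝓘(ℂ).prod 𝓘(ℂ, ℂ →L[ℂ] ℂ)) ω
    (fun x => Bundle.TotalSpace.mk' (ℂ →L[ℂ] ℂ)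
      (E := fun x : S => TangentSpace 𝓘(ℂ) x →L[ℂ] Bundle.Trivial S ℂ x) x (α x)) s

/-- The differential of a function, as a covector field. -/
def differential (f : S → ℂ) : CovectorField S := fun x => mfderiv 𝓘(ℂ) 𝓘(ℂ) f x

theorem HolomorphicFormAt.differential {f : S → ℂ} {s : S}
    (hf : ContMDiffAt 𝓘(ℂ) 𝓘(ℂ) ω f s) : HolomorphicFormAt (differential f) s := by
  unfold HolomorphicFormAt
  rw [contMDiffAt_hom_bundle]
  refine ⟨contMDiffAt_id, ?_⟩
  -- No regularity is lost in differentiating, since `ω + 1 = ω`.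
  have h := ContMDiffAt.mfderiv_const (m := ω) hf le_rfl
  refine h.congr_of_eventuallyEq (Eventually.of_forall fun x => ?_)
  simp only [inTangentCoordinates, ContinuousLinearMap.inCoordinates, TameRational.differential]
  ext
  simp
  rfl

theorem HolomorphicFormAt.add {α β : CovectorField S} {s : S} (hα : HolomorphicFormAt α s)
    (hβ : HolomorphicFormAt β s) : HolomorphicFormAt (α + β) s :=
  ContMDiffAt.add_section hα hβ

theorem HolomorphicFormAt.zero (s : S) : HolomorphicFormAt (0 : CovectorField S) s :=
  (Bundle.contMDiff_zeroSection ℂ _).contMDiffAt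

theorem HolomorphicFormAt.smul {f : S → ℂ} {α : CovectorField S} {s : S}
    (hf : ContMDiffAt 𝓘(ℂ) 𝓘(ℂ) ω f s) (hα : HolomorphicFormAt α s) :
    HolomorphicFormAt (fun x => f x • α x) s :=
  ContMDiffAt.smul_section hf hα

theorem HolomorphicFormAt.congr {α β : CovectorField S} {s : S} (hα : HolomorphicFormAt α s)
    (h : ∀ᶠ x in 𝓝 s, α x = β x) : HolomorphicFormAt β s := by
  refine ContMDiffAt.congr_of_eventuallyEq hα ?_
  filter_upwards [h] with x hx
  rw [hx]

theorem HolomorphicFormAt.eventually {α : CovectorField S} {s : S} (hα : HolomorphicFormAt α s) :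
    ∀ᶠ x in 𝓝 s, HolomorphicFormAt α x :=
  (contMDiffAt_iff_contMDiffAt_nhds (by simp)).1 hα

/-- Both fields are continuous in a local trivialization, so the limits at `s` agree there, and a
trivialization is injective on the fibre. -/
theorem HolomorphicFormAt.eq_of_eventually_nhdsNE {α β : CovectorField S} {s : S}
    (hα : HolomorphicFormAt α s) (hβ : HolomorphicFormAt β s)
    (h : ∀ᶠ x in 𝓝[≠] s, α x = β x) : α s = β s := by
  have := nhdsNE_neBot s
  have h1 := ((Bundle.contMDiffAt_section s).1 hα).continuousAt
  have h2 := ((Bundle.contMDiffAt_section s).1 hβ).continuousAt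
  have h3 := tendsto_nhds_unique_of_eventuallyEq (h1.mono_left nhdsWithin_le_nhds)
    (h2.mono_left nhdsWithin_le_nhds) (by filter_upwards [h] with x hx; rw [hx])
  have hs := FiberBundle.mem_baseSet_trivializationAt' (F := ℂ →L[ℂ] ℂ)
    (E := fun x : S => TangentSpace 𝓘(ℂ) x →L[ℂ] Bundle.Trivial S ℂ x) s
  have h4 := (Bundle.Trivialization.continuousLinearEquivAt ℂ (trivializationAt (ℂ →L[ℂ] ℂ)
    (fun x : S => TangentSpace 𝓘(ℂ) x →L[ℂ] Bundle.Trivial S ℂ x) s) s hs).injective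
  exact h4 h3

end Forms

/-! ### Pulling back differentials along an embedding into the meromorphic functions -/

/-- A `ℂ`-embedding of a field into the ring of germs of meromorphic functions along the
codiscrete filter, i.e. into the meromorphic functions on `S`. -/
structure MeromorphicEmbedding (K S : Type*) [Field K] [Algebra ℂ K] [TopologicalSpace S]
    [ChartedSpace ℂ S] where
  toRingHom : K →+* Germ (codiscrete S) ℂ
  map_algebraMap : ∀ c : ℂ, toRingHom (algebraMap ℂ K c) = ((fun _ => c : S → ℂ) : Germ _ ℂ)
  exists_rep : ∀ k, ∃ f : S → ℂ, IsMeromorphic f ∧ toRingHom k = (f : Germ _ ℂ)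

namespace MeromorphicEmbedding

universe u v

variable {K : Type u} {S : Type v} [Field K] [Algebra ℂ K] [TopologicalSpace S] [ChartedSpace ℂ S]
  (φ : MeromorphicEmbedding K S)

/-- A meromorphic function representing the image of `k`. -/
def rep (k : K) : S → ℂ := (φ.exists_rep k).choose

theorem isMeromorphic_rep (k : K) : IsMeromorphic (φ.rep k) := (φ.exists_rep k).choose_spec.1

theorem toRingHom_eq_rep (k : K) : φ.toRingHom k = (φ.rep k : Germ _ ℂ) :=
  (φ.exists_rep k).choose_spec.2

theorem rep_eventuallyEq {k : K} {f : S → ℂ} (h : φ.toRingHom k = (f : Germ _ ℂ)) :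
    φ.rep k =ᶠ[codiscrete S] f :=
  Germ.coe_eq.1 ((φ.toRingHom_eq_rep k).symm.trans h)

theorem rep_add (a b : K) : φ.rep (a + b) =ᶠ[codiscrete S] φ.rep a + φ.rep b :=
  φ.rep_eventuallyEq (by rw [map_add, toRingHom_eq_rep, toRingHom_eq_rep, Germ.coe_add])

theorem rep_mul (a b : K) : φ.rep (a * b) =ᶠ[codiscrete S] φ.rep a * φ.rep b :=
  φ.rep_eventuallyEq (by rw [map_mul, toRingHom_eq_rep, toRingHom_eq_rep, Germ.coe_mul])

theorem rep_algebraMap (c : ℂ) : φ.rep (algebraMap ℂ K c) =ᶠ[codiscrete S] fun _ => c :=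
  φ.rep_eventuallyEq (φ.map_algebraMap c)

theorem rep_inv [Nonempty S] {a : K} : φ.rep a⁻¹ =ᶠ[codiscrete S] (φ.rep a)⁻¹ := by
  -- For `a = 0` both sides vanish by the convention `0⁻¹ = 0`, in `K` and pointwise in `ℂ`.
  by_cases ha : a = 0
  · have h := φ.rep_algebraMap 0
    rw [map_zero] at h
    subst ha
    rw [inv_zero]
    filter_upwards [h] with x hx
    rw [Pi.inv_apply, hx, inv_zero]
  have h := φ.rep_mul a a⁻¹
  rw [mul_inv_cancel₀ ha] at h
  have h1 := φ.rep_algebraMap 1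
  rw [map_one] at h1
  filter_upwards [h, h1] with x hx hx1
  rw [hx1, Pi.mul_apply] at hx
  exact eq_inv_of_mul_eq_one_right hx.symm

/-- The order of vanishing of an element of `K` at a point of `S`. -/
def order (s : S) (k : K) : WithTop ℤ :=
  meromorphicOrderAt (φ.rep k ∘ (chartAt ℂ s).symm) (chartAt ℂ s s)

theorem order_congr {s : S} {k : K} {f : S → ℂ} (h : φ.rep k =ᶠ[codiscrete S] f) :
    φ.order s k = meromorphicOrderAt (f ∘ (chartAt ℂ s).symm) (chartAt ℂ s s) :=
  meromorphicOrderAt_congr (eventually_nhdsNE_chartAt_iff.2 (eventually_codiscrete_iff.1 h s))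

theorem order_mul (s : S) (a b : K) : φ.order s (a * b) = φ.order s a + φ.order s b := by
  rw [φ.order_congr (φ.rep_mul a b)]
  exact meromorphicOrderAt_mul (φ.isMeromorphic_rep a s) (φ.isMeromorphic_rep b s)

theorem order_add (s : S) (a b : K) : min (φ.order s a) (φ.order s b) ≤ φ.order s (a + b) := by
  rw [φ.order_congr (φ.rep_add a b)]
  exact meromorphicOrderAt_add (φ.isMeromorphic_rep a s) (φ.isMeromorphic_rep b s)

theorem order_algebraMap_nonneg (s : S) (c : ℂ) : 0 ≤ φ.order s (algebraMap ℂ K c) := by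
  rw [φ.order_congr (φ.rep_algebraMap c)]
  exact AnalyticAt.meromorphicOrderAt_nonneg (f := fun _ => c) analyticAt_const

/-- The valuation ring of the functions in `K` that are holomorphic at `s`. -/
def valuationSubring [Nonempty S] (s : S) : ValuationSubring K where
  carrier := {k | 0 ≤ φ.order s k}
  mul_mem' := fun {a b} ha hb => by
    change 0 ≤ φ.order s (a * b)
    rw [order_mul]
    exact add_nonneg ha hb
  one_mem' := by simpa using φ.order_algebraMap_nonneg s 1
  add_mem' := fun {a b} ha hb => (le_min ha hb).trans (φ.order_add s a b)
  zero_mem' := by simpa using φ.order_algebraMap_nonneg s 0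
  neg_mem' := fun {a} ha => by
    change 0 ≤ φ.order s (-a)
    have h := φ.order_mul s (algebraMap ℂ K (-1)) a
    rw [map_neg, map_one, neg_one_mul] at h
    rw [h]
    have h1 := φ.order_algebraMap_nonneg s (-1)
    rw [map_neg, map_one] at h1
    exact add_nonneg h1 ha
  mem_or_inv_mem' := fun a => by
    change 0 ≤ φ.order s a ∨ 0 ≤ φ.order s a⁻¹
    rw [φ.order_congr (k := a⁻¹) φ.rep_inv]
    have h := meromorphicOrderAt_inv (f := φ.rep a ∘ (chartAt ℂ s).symm) (x := chartAt ℂ s s)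
    have h' : ((φ.rep a)⁻¹ ∘ (chartAt ℂ s).symm) = (φ.rep a ∘ (chartAt ℂ s).symm)⁻¹ := rfl
    rw [h', h]
    change 0 ≤ φ.order s a ∨ 0 ≤ -φ.order s a
    generalize φ.order s a = n
    cases n with
    | top => left; exact le_top
    | coe n =>
      rcases le_total 0 n with h | h
      · left; exact_mod_cast h
      · right; exact_mod_cast neg_nonneg.2 h

theorem exists_contMDiffAt_of_mem [Nonempty S] [IsManifold 𝓘(ℂ) ω S] {s : S} {k : K}
    (hk : k ∈ φ.valuationSubring s) :
    ∃ g : S → ℂ, ContMDiffAt 𝓘(ℂ) 𝓘(ℂ) ω g s ∧ φ.rep k =ᶠ[𝓝[≠] s] g :=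
  exists_contMDiffAt_of_order_nonneg (φ.isMeromorphic_rep k s) hk

/-- Germs of covector fields along the codiscrete filter, with the `K`-module structure induced
by the embedding of `K` into the meromorphic functions. -/
def FormGerm (_ : MeromorphicEmbedding K S) : Type _ := Germ (codiscrete S) (ℂ →L[ℂ] ℂ)

instance : AddCommGroup φ.FormGerm :=
  inferInstanceAs (AddCommGroup (Germ (codiscrete S) (ℂ →L[ℂ] ℂ)))

instance : Module (Germ (codiscrete S) ℂ) φ.FormGerm :=
  inferInstanceAs (Module (Germ (codiscrete S) ℂ) (Germ (codiscrete S) (ℂ →L[ℂ] ℂ)))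

/-- The action of `K` depends on the embedding, which is why `FormGerm` carries `φ` as an argument.
-/
instance : Module K φ.FormGerm := Module.compHom _ φ.toRingHom

instance : Module ℂ φ.FormGerm := Module.compHom _ (algebraMap ℂ K)

instance : IsScalarTower ℂ K φ.FormGerm where
  smul_assoc c k x := by
    rw [Algebra.smul_def, mul_smul]
    rfl

/-- The germ of a covector field. -/
def formGerm (α : CovectorField S) : φ.FormGerm :=
  Germ.ofFun (l := codiscrete S) (β := ℂ →L[ℂ] ℂ) α

theorem formGerm_eq_iff {α β : CovectorField S} :
    φ.formGerm α = φ.formGerm β ↔ ∀ᶠ x in codiscrete S, α x = β x := Germ.coe_eq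

theorem formGerm_surjective : Function.Surjective φ.formGerm := fun x => by
  induction x using Germ.inductionOn with
  | h f => exact ⟨f, rfl⟩

theorem formGerm_add (α β : CovectorField S) :
    φ.formGerm (α + β) = φ.formGerm α + φ.formGerm β := rfl

theorem formGerm_zero : φ.formGerm 0 = 0 := rfl

theorem smul_formGerm (k : K) (α : CovectorField S) :
    k • φ.formGerm α = φ.formGerm (fun x => φ.rep k x • α x) := by
  change φ.toRingHom k • φ.formGerm α = _
  rw [toRingHom_eq_rep]
  rfl

theorem const_smul_formGerm (c : ℂ) (α : CovectorField S) :
    c • φ.formGerm α = φ.formGerm (c • α) := by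
  change algebraMap ℂ K c • φ.formGerm α = _
  rw [smul_formGerm, formGerm_eq_iff]
  filter_upwards [φ.rep_algebraMap c] with x hx
  rw [hx]
  rfl

/-- By continuity a holomorphic form is determined by its germ. This uniqueness makes the chosen
pullbacks in `pullbackFirstKind` linear. -/
theorem holomorphicOneForm_ext [IsManifold 𝓘(ℂ) ω S] {α β : HolomorphicOneForm S} (h : φ.formGerm α = φ.formGerm β) :
    α = β := by
  rw [formGerm_eq_iff, eventually_codiscrete_iff] at h
  refine ContMDiffSection.ext fun s => ?_
  exact HolomorphicFormAt.eq_of_eventually_nhdsNE (α.contMDiff s) (β.contMDiff s) (h s)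

variable [T1Space S]

/-- Functions equal on a punctured neighbourhood are equal near each of its points, so their
derivatives agree there too. Hence the differential does not depend on the representative. -/
theorem formGerm_differential_congr {f g : S → ℂ} (h : f =ᶠ[codiscrete S] g) :
    φ.formGerm (differential f) = φ.formGerm (differential g) := by
  rw [formGerm_eq_iff, eventually_codiscrete_iff]
  intro s
  have h1 := eventually_nhdsNE_eventually_nhds_iff.2 (eventually_codiscrete_iff.1 h s)
  filter_upwards [h1] with x hx
  have hx' : f =ᶠ[𝓝 x] g := hx
  exact hx'.mfderiv_eq

theorem formGerm_differential_algebraMap (c : ℂ) :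
    φ.formGerm (differential (φ.rep (algebraMap ℂ K c))) = 0 := by
  rw [φ.formGerm_differential_congr (φ.rep_algebraMap c), ← formGerm_zero, formGerm_eq_iff]
  exact Eventually.of_forall fun x => mfderiv_const

variable [IsManifold 𝓘(ℂ) ω S]

theorem formGerm_differential_add (a b : K) :
    φ.formGerm (differential (φ.rep (a + b))) =
      φ.formGerm (differential (φ.rep a)) + φ.formGerm (differential (φ.rep b)) := by
  rw [φ.formGerm_differential_congr (φ.rep_add a b), ← formGerm_add, formGerm_eq_iff]
  filter_upwards [(φ.isMeromorphic_rep a).eventually_mdifferentiableAt,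
    (φ.isMeromorphic_rep b).eventually_mdifferentiableAt] with x ha hb
  exact mfderiv_add ha hb

theorem formGerm_differential_mul (a b : K) :
    φ.formGerm (differential (φ.rep (a * b))) =
      a • φ.formGerm (differential (φ.rep b)) + b • φ.formGerm (differential (φ.rep a)) := by
  rw [φ.formGerm_differential_congr (φ.rep_mul a b), smul_formGerm, smul_formGerm,
    ← formGerm_add, formGerm_eq_iff]
  filter_upwards [(φ.isMeromorphic_rep a).eventually_mdifferentiableAt,
    (φ.isMeromorphic_rep b).eventually_mdifferentiableAt] with x ha hb
  exact (ha.hasMFDerivAt.mul hb.hasMFDerivAt).mfderiv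

/-- The derivation of `K` given by differentiating meromorphic functions. -/
def derivation : Derivation ℂ K φ.FormGerm :=
  Derivation.mk'
    { toFun := fun k => φ.formGerm (differential (φ.rep k))
      map_add' := φ.formGerm_differential_add
      map_smul' := fun c k => by
        rw [Algebra.smul_def, formGerm_differential_mul, formGerm_differential_algebraMap,
          smul_zero, add_zero]
        rfl }
    φ.formGerm_differential_mul

theorem derivation_apply (k : K) : φ.derivation k = φ.formGerm (differential (φ.rep k)) := rfl

/-- Pullback of Kähler differentials to meromorphic forms. -/
def pullback : Ω[K⁄ℂ] →ₗ[K] φ.FormGerm := φ.derivation.liftKaehlerDifferential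

theorem pullback_D (k : K) :
    φ.pullback (KaehlerDifferential.D ℂ K k) = φ.formGerm (differential (φ.rep k)) :=
  φ.derivation.liftKaehlerDifferential_comp_D k

/-- Near `s`, a differential regular at the place of `s` pulls back to a holomorphic form. -/
theorem exists_holomorphicFormAt [Nonempty S] {s : S} {η : Ω[K⁄ℂ]}
    (hη : η ∈ Submodule.span (φ.valuationSubring s)
      (KaehlerDifferential.D ℂ K '' (φ.valuationSubring s : Set K))) :
    ∃ α β : CovectorField S, φ.pullback η = φ.formGerm α ∧ HolomorphicFormAt β s ∧
      ∀ᶠ x in 𝓝[≠] s, α x = β x := by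
  induction hη using Submodule.span_induction with
  | mem x hx =>
    obtain ⟨k, hk, rfl⟩ := hx
    obtain ⟨g, hg, hkg⟩ := φ.exists_contMDiffAt_of_mem hk
    refine ⟨_, differential g, φ.pullback_D k, HolomorphicFormAt.differential hg, ?_⟩
    filter_upwards [eventually_nhdsNE_eventually_nhds_iff.2 hkg] with x hx
    exact Filter.EventuallyEq.mfderiv_eq hx
  | zero => exact ⟨0, 0, by rw [map_zero, formGerm_zero], HolomorphicFormAt.zero s, by simp⟩
  | add x y _ _ hx hy =>
    obtain ⟨α, β, h1, h2, h3⟩ := hx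
    obtain ⟨α', β', h1', h2', h3'⟩ := hy
    refine ⟨α + α', β + β', by rw [map_add, h1, h1', formGerm_add], h2.add h2', ?_⟩
    filter_upwards [h3, h3'] with x hx hx'
    rw [Pi.add_apply, Pi.add_apply, hx, hx']
  | smul k x _ hx =>
    obtain ⟨α, β, h1, h2, h3⟩ := hx
    obtain ⟨g, hg, hkg⟩ := φ.exists_contMDiffAt_of_mem k.2
    refine ⟨fun x => φ.rep k x • α x, fun x => g x • β x, ?_, HolomorphicFormAt.smul hg h2, ?_⟩
    · rw [← smul_formGerm, ← h1, ← map_smul]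
      rfl
    · filter_upwards [h3, hkg] with x hx hx'
      rw [hx, hx']

/-- Regularity at the place of each `s` gives a holomorphic extension `β s` near `s` of one common
germ. The extensions agree on overlaps by continuity, so `x ↦ β x x` is a global form. -/
theorem exists_holomorphicOneForm [Nonempty S] (η : firstKindDifferentials K) :
    ∃ α : HolomorphicOneForm S, φ.pullback η = φ.formGerm α := by
  have h : ∀ s, ∃ α β : CovectorField S, φ.pullback η = φ.formGerm α ∧ HolomorphicFormAt β s ∧
      ∀ᶠ x in 𝓝[≠] s, α x = β x := fun s =>
    φ.exists_holomorphicFormAt (η.2 (φ.valuationSubring s) (φ.order_algebraMap_nonneg s))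
  obtain ⟨α, hα⟩ := φ.formGerm_surjective (φ.pullback η)
  have h' : ∀ s, ∃ β : CovectorField S, HolomorphicFormAt β s ∧ ∀ᶠ x in 𝓝[≠] s, α x = β x := by
    intro s
    obtain ⟨α', β, h1, h2, h3⟩ := h s
    refine ⟨β, h2, ?_⟩
    rw [h1, formGerm_eq_iff, eventually_codiscrete_iff] at hα
    filter_upwards [h3, hα s] with x hx hx'
    rw [hx', hx]
  choose β hβ hαβ using h'
  have key : ∀ s, ∀ᶠ x in 𝓝 s, β s x = β x x := by
    intro s
    have h1 := eventually_nhdsNE_eventually_nhds_iff.2 (hαβ s)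
    rw [eventually_nhdsWithin_iff] at h1
    filter_upwards [h1, (hβ s).eventually] with x hx hx'
    by_cases hxs : x = s
    · rw [hxs]
    -- Both extensions are holomorphic at `x` and coincide with `α` on a punctured neighbourhood of
    -- `x`.
    refine hx'.eq_of_eventually_nhdsNE (hβ x) ?_
    filter_upwards [nhdsWithin_le_nhds (hx hxs), hαβ x] with y hy hy'
    rw [← hy, hy']
  refine ⟨⟨fun x => β x x, fun s => (hβ s).congr (key s)⟩, ?_⟩
  rw [← hα, formGerm_eq_iff, eventually_codiscrete_iff]
  intro s
  filter_upwards [hαβ s, nhdsWithin_le_nhds (key s)] with x hx hx'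
  rw [hx, hx']
  rfl

/-- The pullback of differentials of the first kind to holomorphic `1`-forms. -/
def pullbackFirstKind [Nonempty S] : firstKindDifferentials K →ₗ[ℂ] HolomorphicOneForm S where
  toFun η := (φ.exists_holomorphicOneForm η).choose
  map_add' η ξ := φ.holomorphicOneForm_ext <| by
    have h1 := (φ.exists_holomorphicOneForm η).choose_spec
    have h2 := (φ.exists_holomorphicOneForm ξ).choose_spec
    rw [← (φ.exists_holomorphicOneForm (η + ξ)).choose_spec, Submodule.coe_add, map_add]
    exact congrArg₂ (· + ·) h1 h2
  map_smul' c η := φ.holomorphicOneForm_ext <| by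
    rw [← (φ.exists_holomorphicOneForm (c • η)).choose_spec, Submodule.coe_smul]
    have h : φ.pullback (c • (η : Ω[K⁄ℂ])) = c • φ.pullback η := by
      rw [← algebraMap_smul K c (η : Ω[K⁄ℂ]), map_smul]
      rfl
    have h1 := (φ.exists_holomorphicOneForm η).choose_spec
    rw [h]
    exact (congrArg (c • ·) h1).trans (φ.const_smul_formGerm c _)

theorem pullback_eq_pullbackFirstKind [Nonempty S] (η : firstKindDifferentials K) :
    φ.pullback η = φ.formGerm (φ.pullbackFirstKind η) :=
  (φ.exists_holomorphicOneForm η).choose_spec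

/-- The pullback is injective if the differentials are spanned by `du` with `u` pulling back to a
function of nonzero differential. -/
theorem pullback_injective [PreconnectedSpace S] [Nonempty S] {u : K}
    (hspan : ∀ η : Ω[K⁄ℂ], ∃ k : K, η = k • KaehlerDifferential.D ℂ K u)
    (hu : φ.derivation u ≠ 0) : Function.Injective φ.pullback := by
  rw [injective_iff_map_eq_zero]
  intro η hη
  obtain ⟨k, rfl⟩ := hspan η
  rw [map_smul, pullback_D, ← derivation_apply] at hη
  rcases smul_eq_zero.1 hη with h | h
  · rw [h, zero_smul]
  · exact absurd h hu

theorem lift_functionFieldGenus_le [PreconnectedSpace S] [Nonempty S] {u : K}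
    (hspan : ∀ η : Ω[K⁄ℂ], ∃ k : K, η = k • KaehlerDifferential.D ℂ K u)
    (hu : φ.derivation u ≠ 0) :
    Cardinal.lift.{v} (functionFieldGenus K) ≤ Cardinal.lift.{u} (surfaceGenus S) := by
  refine LinearMap.lift_rank_le_of_injective φ.pullbackFirstKind fun η ξ h => ?_
  refine Subtype.ext (φ.pullback_injective hspan hu ?_)
  rw [pullback_eq_pullbackFirstKind, pullback_eq_pullbackFirstKind, h]

end MeromorphicEmbedding

/-! ### Function fields of plane curves -/

section PlaneCurve

open MvPolynomial

/-- A nonzero partial derivative has smaller total degree than `F`, so divisibility would force all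
partials to vanish; in characteristic zero `F` would then be constant. -/
theorem exists_not_dvd_pderiv {σ R : Type*} [CommRing R] [IsDomain R] [CharZero R]
    {F : MvPolynomial σ R} (hF : ∀ c, F ≠ C c) : ∃ i, ¬ F ∣ pderiv i F := by
  by_contra! h
  have h0 : ∀ i, pderiv i F = 0 := by
    intro i
    by_contra hne
    have h1 := totalDegree_le_of_dvd_of_isDomain (h i) hne
    obtain ⟨m, hm, hdeg⟩ := Finset.exists_mem_eq_sup (pderiv i F).support
      (by rwa [Finset.nonempty_iff_ne_empty, Ne, support_eq_empty])
      (fun m => m.sum fun _ e => e)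
    have h2 : m + Finsupp.single i 1 ∈ F.support := by
      rw [mem_support_iff, coeff_pderiv] at hm
      exact mem_support_iff.2 (left_ne_zero_of_mul hm)
    have h3 := le_totalDegree h2
    change (pderiv i F).totalDegree = m.degree at hdeg
    rw [hdeg] at h1
    have h4 : (m + Finsupp.single i 1).sum (fun _ e => e) = m.degree + 1 := by
      change (m + Finsupp.single i 1).degree = _
      simp
    omega
  refine hF (coeff 0 F) ?_
  ext m
  classical
  rw [coeff_C]
  split_ifs with hm
  · rw [hm]
  · obtain ⟨i, hi⟩ := Finsupp.ne_iff.1 (Ne.symm hm)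
    have h1 := coeff_pderiv (i := i) F (m - Finsupp.single i 1)
    have h2 : m - Finsupp.single i 1 + Finsupp.single i 1 = m := by
      refine tsub_add_cancel_of_le ?_
      rw [Finsupp.single_le_iff]
      exact Nat.one_le_iff_ne_zero.2 hi
    rw [h0 i, coeff_zero, h2] at h1
    refine (mul_eq_zero.1 h1.symm).resolve_right ?_
    exact Nat.cast_add_one_ne_zero _

theorem derivation_aeval_eq_sum {σ R A M : Type*} [Fintype σ] [CommRing R] [CommRing A]
    [Algebra R A] [AddCommGroup M] [Module A M] [Module R M] [IsScalarTower R A M]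
    (D : Derivation R A M) (x : σ → A) (P : MvPolynomial σ R) :
    D (aeval x P) = ∑ i, aeval x (pderiv i P) • D (x i) := by
  classical
  induction P using MvPolynomial.induction_on with
  | C a => simp
  | add p q hp hq => simp [hp, hq, add_smul, Finset.sum_add_distrib]
  | mul_X p i hp =>
    rw [map_mul, aeval_X, Derivation.leibniz, hp]
    simp only [pderiv_mul, pderiv_X, map_add, map_mul, aeval_X, add_smul,
      Finset.sum_add_distrib, Finset.smul_sum, smul_smul, mul_comm (x i)]
    rw [add_comm]
    congr 1
    rw [Finset.sum_eq_single i]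
    · simp
    · intro j _ hj
      simp [Pi.single_eq_of_ne hj.symm]
    · simp

variable (F : MvPolynomial (Fin 2) ℂ)

/-- The function field of the plane curve `F = 0`. -/
abbrev PlaneFunctionField : Type :=
  FractionRing (MvPolynomial (Fin 2) ℂ ⧸ Ideal.span {F})

/-- The coordinate functions, as elements of the function field. -/
def planeCoord (i : Fin 2) : PlaneFunctionField F :=
  algebraMap (MvPolynomial (Fin 2) ℂ ⧸ Ideal.span {F}) _ (Ideal.Quotient.mk _ (X i))

theorem aeval_planeCoord (P : MvPolynomial (Fin 2) ℂ) :
    aeval (planeCoord F) P =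
      algebraMap (MvPolynomial (Fin 2) ℂ ⧸ Ideal.span {F}) _ (Ideal.Quotient.mk _ P) := by
  induction P using MvPolynomial.induction_on with
  | C a =>
    rw [aeval_C, IsScalarTower.algebraMap_apply ℂ (MvPolynomial (Fin 2) ℂ ⧸ Ideal.span {F})]
    rfl
  | add p q hp hq => rw [map_add, hp, hq, map_add, map_add]
  | mul_X p i hp => rw [map_mul, hp, aeval_X, planeCoord, map_mul, map_mul]

variable [hP : (Ideal.span {F}).IsPrime]

theorem aeval_planeCoord_eq_zero_iff (P : MvPolynomial (Fin 2) ℂ) :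
    aeval (planeCoord F) P = 0 ↔ F ∣ P := by
  rw [aeval_planeCoord, FaithfulSMul.algebraMap_eq_zero_iff, Ideal.Quotient.eq_zero_iff_mem,
    Ideal.mem_span_singleton]

theorem exists_eq_aeval_div (k : PlaneFunctionField F) :
    ∃ P Q : MvPolynomial (Fin 2) ℂ, ¬ F ∣ Q ∧ k = aeval (planeCoord F) P / aeval (planeCoord F) Q := by
  obtain ⟨a, b, hb, rfl⟩ := IsFractionRing.div_surjective
    (A := MvPolynomial (Fin 2) ℂ ⧸ Ideal.span {F}) k
  obtain ⟨P, rfl⟩ := Ideal.Quotient.mk_surjective a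
  obtain ⟨Q, rfl⟩ := Ideal.Quotient.mk_surjective b
  refine ⟨P, Q, ?_, by rw [aeval_planeCoord, aeval_planeCoord]⟩
  rw [← Ideal.mem_span_singleton, ← Ideal.Quotient.eq_zero_iff_mem]
  exact nonZeroDivisors.ne_zero hb

/-- The differentials of the function field of a plane curve are spanned by one of `dx`, `dy`. -/
theorem exists_forall_eq_smul_D (hF : Irreducible F) :
    ∃ i, ∀ η : Ω[PlaneFunctionField F⁄ℂ],
      ∃ k : PlaneFunctionField F, η = k • KaehlerDifferential.D ℂ _ (planeCoord F i) := by
  set K := PlaneFunctionField F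
  set D := KaehlerDifferential.D ℂ K
  have hC : ∀ c, F ≠ C c := by
    rintro c rfl
    by_cases hc : c = 0
    · exact hF.ne_zero (by rw [hc, map_zero])
    · exact hF.not_isUnit ((isUnit_iff_ne_zero.2 hc).map C)
  obtain ⟨j, hj⟩ := exists_not_dvd_pderiv hC
  obtain ⟨i, hi⟩ : ∃ i : Fin 2, ∀ l, l = i ∨ l = j := by
    fin_cases j
    · exact ⟨1, by decide⟩
    · exact ⟨0, by decide⟩
  refine ⟨i, ?_⟩
  have hcoord : ∀ l, ∃ k : K, D (planeCoord F l) = k • D (planeCoord F i) := by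
    intro l
    by_cases hij : i = j
    · rcases hi l with rfl | rfl
      · exact ⟨1, (one_smul _ _).symm⟩
      · exact ⟨1, by rw [hij, one_smul]⟩
    rcases hi l with rfl | rfl
    · exact ⟨1, (one_smul _ _).symm⟩
    -- Differentiating `F(x, y) = 0` gives a linear relation between `dx` and `dy`. The coefficient
    -- at `l` is nonzero by the choice of the partial derivative, so the relation can be solved.
    have h1 := derivation_aeval_eq_sum D (planeCoord F) F
    rw [(aeval_planeCoord_eq_zero_iff F F).2 dvd_rfl, map_zero] at h1
    have hu : (Finset.univ : Finset (Fin 2)) = {i, l} := by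
      ext m
      simpa using hi m
    rw [hu, Finset.sum_pair hij] at h1
    have hne : aeval (planeCoord F) (pderiv l F) ≠ 0 := fun h =>
      hj ((aeval_planeCoord_eq_zero_iff F _).1 h)
    refine ⟨-((aeval (planeCoord F) (pderiv l F))⁻¹ * aeval (planeCoord F) (pderiv i F)), ?_⟩
    rw [neg_smul, mul_smul, eq_neg_of_add_eq_zero_left h1.symm, smul_neg, neg_neg,
      inv_smul_smul₀ hne]
  set N : Submodule K Ω[K⁄ℂ] := Submodule.span K {D (planeCoord F i)}
  have hN : ∀ l, D (planeCoord F l) ∈ N := fun l => by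
    obtain ⟨k, hk⟩ := hcoord l
    rw [hk]
    exact N.smul_mem k (Submodule.mem_span_singleton_self _)
  have hpoly : ∀ P, D (aeval (planeCoord F) P) ∈ N := fun P => by
    rw [derivation_aeval_eq_sum]
    exact N.sum_mem fun l _ => N.smul_mem _ (hN l)
  have htop : N = ⊤ := by
    rw [eq_top_iff, ← KaehlerDifferential.span_range_derivation ℂ K, Submodule.span_le]
    rintro _ ⟨k, rfl⟩
    obtain ⟨P, Q, hQ, rfl⟩ := exists_eq_aeval_div F k
    rw [Derivation.leibniz_div]
    exact N.smul_mem _ (N.sub_mem (N.smul_mem _ (hpoly P)) (N.smul_mem _ (hpoly Q)))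
  intro η
  obtain ⟨k, hk⟩ := Submodule.mem_span_singleton.1 (htop ▸ Submodule.mem_top : η ∈ N)
  exact ⟨k, hk.symm⟩

/-- A non-maximal prime ideal of `ℂ[x, y]` containing an irreducible polynomial is generated
by it. -/
theorem eq_span_singleton_of_irreducible_mem {I : Ideal (MvPolynomial (Fin 2) ℂ)} [I.IsPrime]
    (hI : ¬ I.IsMaximal) {F : MvPolynomial (Fin 2) ℂ} (hF : Irreducible F) (hFI : F ∈ I) :
    I = Ideal.span {F} := by
  have := span_singleton_isPrime hF
  by_contra hne
  have hlt : Ideal.span {F} < I := lt_of_le_of_ne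
    ((Ideal.span_singleton_le_iff_mem I).2 hFI) (Ne.symm hne)
  have hbot : (⊥ : Ideal (MvPolynomial (Fin 2) ℂ)) < Ideal.span {F} := by
    rw [bot_lt_iff_ne_bot, Ne, Ideal.span_singleton_eq_bot]
    exact hF.ne_zero
  have hdim : ringKrullDim (MvPolynomial (Fin 2) ℂ) = 2 := by
    rw [MvPolynomial.ringKrullDim_of_isNoetherianRing, ringKrullDim_eq_zero_of_field]
    simp
  obtain ⟨M, hM, hIM⟩ := I.exists_le_maximal (Ideal.IsPrime.ne_top inferInstance)
  have hIMlt : I < M := lt_of_le_of_ne hIM fun h => hI (h ▸ hM)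
  have : M.IsPrime := hM.isPrime
  -- The chain `0 < (F) < I < M` would have length three in a ring of dimension two.
  have h1 := Ideal.height_add_one_le_of_lt_of_isPrime hbot
  have h2 := Ideal.height_add_one_le_of_lt_of_isPrime hlt
  have h3 := Ideal.height_add_one_le_of_lt_of_isPrime hIMlt
  have h4 := M.height_le_ringKrullDim_of_ne_top hM.ne_top
  rw [hdim] at h4
  have h5 : M.height ≤ 2 := WithBot.coe_le_coe.1 h4
  have h6 : (0 : ℕ∞) + 1 + 1 + 1 ≤ 2 :=
    (add_le_add_left ((add_le_add_left ((add_le_add_left bot_le 1).trans h1) 1).trans h2)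
      1).trans (h3.trans h5)
  norm_num at h6

end PlaneCurve

/-! ### Curves parametrized by meromorphic functions -/

section Relations

variable {S : Type*} [TopologicalSpace S]

variable (v : Fin 2 → S → ℂ)

/-- Substitution of functions into polynomials, up to codiscrete equality. -/
def substitution : MvPolynomial (Fin 2) ℂ →+* Germ (codiscrete S) ℂ :=
  (Germ.coeRingHom (codiscrete S)).comp (MvPolynomial.aeval v).toRingHom

theorem substitution_apply (P : MvPolynomial (Fin 2) ℂ) :
    substitution v P = ((MvPolynomial.aeval v P : S → ℂ) : Germ (codiscrete S) ℂ) := rfl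

/-- The ideal of relations between meromorphic functions. -/
abbrev relationIdeal : Ideal (MvPolynomial (Fin 2) ℂ) := RingHom.ker (substitution v)

variable {v}

theorem mem_relationIdeal {P : MvPolynomial (Fin 2) ℂ} :
    P ∈ relationIdeal v ↔ ∀ᶠ x in codiscrete S, MvPolynomial.aeval v P x = 0 := by
  rw [RingHom.mem_ker, substitution_apply]
  exact Germ.coe_eq

/-- By the Nullstellensatz a maximal ideal is the ideal of a point, and `v i` would be constantly a
coordinate of that point. -/
theorem not_isMaximal_relationIdeal {i : Fin 2}
    (hi : ∀ c, ¬ ∀ᶠ x in codiscrete S, v i x = c) : ¬ (relationIdeal v).IsMaximal := by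
  intro h
  obtain ⟨p, hp⟩ := MvPolynomial.isMaximal_iff_eq_vanishingIdeal_singleton.1 h
  have h1 : MvPolynomial.X i - MvPolynomial.C (p i) ∈ relationIdeal v := by
    rw [hp, MvPolynomial.mem_vanishingIdeal_singleton_iff]
    simp
  refine hi (p i) ?_
  filter_upwards [mem_relationIdeal.1 h1] with x hx
  rw [map_sub, MvPolynomial.aeval_X, MvPolynomial.aeval_C, Pi.sub_apply, sub_eq_zero] at hx
  exact hx

end Relations

/-! ### Function fields of parametrized curves inside the meromorphic functions -/

section Parametrization

variable {S : Type*} [TopologicalSpace S] [ChartedSpace ℂ S]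

theorem IsMeromorphic.eventually_eq_or_ne [T1Space S] [PreconnectedSpace S] {f : S → ℂ}
    (hf : IsMeromorphic f) (c : ℂ) :
    (∀ᶠ x in codiscrete S, f x = c) ∨ ∀ᶠ x in codiscrete S, f x ≠ c := by
  have h := (hf.add (IsMeromorphic.const (-c))).eventually_eq_zero_or_ne_zero
  simpa only [Pi.add_apply, ← sub_eq_add_neg, sub_eq_zero, ne_eq] using h

/-- The function is constant on a small disc around a point where it is holomorphic, and the
identity principle spreads this over the connected surface. -/
theorem IsMeromorphic.exists_eventually_eq_of_differential_eq_zero [T1Space S]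
    [ConnectedSpace S] [IsManifold 𝓘(ℂ) ω S] {f : S → ℂ} (hf : IsMeromorphic f)
    (h : ∀ᶠ x in codiscrete S, differential f x = 0) :
    ∃ c, ∀ᶠ x in codiscrete S, f x = c := by
  obtain ⟨s⟩ : Nonempty S := inferInstance
  have := nhdsNE_neBot s
  have h1 := eventually_codiscrete_iff.1 (hf.eventually_mdifferentiableAt.and h) s
  obtain ⟨p, hp⟩ := (eventually_nhdsNE_eventually_nhds_iff.2 h1).exists
  set e := chartAt ℂ p
  have h2 : ∀ᶠ z in 𝓝 (e p), HasDerivAt (f ∘ e.symm) 0 z := by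
    filter_upwards [eventually_nhds_chartAt_iff.2 hp,
      e.open_target.mem_nhds (mem_chart_target ℂ p)] with z hz hzt
    have h3 : MDifferentiableAt 𝓘(ℂ) 𝓘(ℂ) e.symm z :=
      mdifferentiableAt_atlas_symm (chart_mem_atlas ℂ p) hzt
    have h4 := hz.1.hasMFDerivAt.comp z h3.hasMFDerivAt
    rw [show mfderiv 𝓘(ℂ) 𝓘(ℂ) f (e.symm z) = 0 from hz.2, ContinuousLinearMap.zero_comp] at h4
    have h5 : HasFDerivAt (f ∘ e.symm) (0 : ℂ →L[ℂ] ℂ) z := h4.hasFDerivAt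
    simpa using h5.hasDerivAt
  obtain ⟨r, hr, hball⟩ := Metric.eventually_nhds_iff_ball.1 h2
  have h3 : ∀ z ∈ Metric.ball (e p) r, f (e.symm z) = f p := by
    intro z hz
    have h4 := Metric.isOpen_ball.is_const_of_deriv_eq_zero (f := f ∘ e.symm)
      (convex_ball (e p) r).isPreconnected
      (fun w hw => (hball w hw).differentiableAt.differentiableWithinAt)
      (fun w hw => (hball w hw).deriv) hz (Metric.mem_ball_self hr)
    simpa [e, (chartAt ℂ p).left_inv (mem_chart_source ℂ p)] using h4
  have h4 : ∀ᶠ x in 𝓝 p, f x = f p :=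
    eventually_nhds_chartAt_iff.1 (eventually_of_mem (Metric.ball_mem_nhds _ hr) h3)
  refine ⟨f p, (hf.eventually_eq_or_ne (f p)).resolve_right fun h5 => ?_⟩
  have := nhdsNE_neBot p
  obtain ⟨x, hx, hx'⟩ :=
    ((eventually_codiscrete_iff.1 h5 p).and (nhdsWithin_le_nhds h4)).exists
  exact hx hx'

variable {v : Fin 2 → S → ℂ} [T1Space S] [ConnectedSpace S]

theorem eventually_ne_zero_of_notMem (hv : ∀ i, IsMeromorphic (v i))
    {P : MvPolynomial (Fin 2) ℂ} (hP : P ∉ relationIdeal v) :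
    ∀ᶠ x in codiscrete S, MvPolynomial.aeval v P x ≠ 0 :=
  (IsMeromorphic.aeval hv P).eventually_eq_zero_or_ne_zero.resolve_left
    fun h => hP (mem_relationIdeal.2 h)

/-- Meromorphic functions on a connected surface have no zero divisors: two that are not identically
zero are simultaneously nonzero off a discrete set. -/
theorem isPrime_relationIdeal (hv : ∀ i, IsMeromorphic (v i)) : (relationIdeal v).IsPrime := by
  have := codiscrete_neBot (S := S)
  refine ⟨RingHom.ker_ne_top _, fun {P Q} hPQ => ?_⟩
  by_contra! h
  rw [mem_relationIdeal] at hPQ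
  obtain ⟨x, h1, h2, h3⟩ := (hPQ.and ((eventually_ne_zero_of_notMem hv h.1).and
    (eventually_ne_zero_of_notMem hv h.2))).exists
  rw [map_mul, Pi.mul_apply] at h1
  exact (mul_ne_zero h2 h3) h1

/-- A polynomial outside the relation ideal becomes an invertible germ, so substitution extends from
the coordinate ring to its fraction field. -/
theorem exists_meromorphicEmbedding (hv : ∀ i, IsMeromorphic (v i))
    {F : MvPolynomial (Fin 2) ℂ} [hP : (Ideal.span {F}).IsPrime]
    (hF : relationIdeal v = Ideal.span {F}) :
    ∃ φ : MeromorphicEmbedding (PlaneFunctionField F) S,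
      ∀ i, φ.toRingHom (planeCoord F i) = (v i : Germ (codiscrete S) ℂ) := by
  let A := MvPolynomial (Fin 2) ℂ ⧸ Ideal.span {F}
  let g : A →+* Germ (codiscrete S) ℂ :=
    Ideal.Quotient.lift (Ideal.span {F}) (substitution v) fun P hP => by
      rw [← hF] at hP
      exact hP
  have hg : ∀ P, g (Ideal.Quotient.mk _ P) = substitution v P := fun P => rfl
  have hinv : ∀ Q, Q ∉ relationIdeal v →
      substitution v Q * (((MvPolynomial.aeval v Q)⁻¹ : S → ℂ) : Germ (codiscrete S) ℂ) = 1 := by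
    intro Q hQ
    rw [substitution_apply, ← Germ.coe_mul, ← Germ.coe_one]
    refine Germ.coe_eq.2 ?_
    filter_upwards [eventually_ne_zero_of_notMem hv hQ] with x hx
    rw [Pi.mul_apply, Pi.inv_apply, mul_inv_cancel₀ hx, Pi.one_apply]
  have hunit : ∀ y : nonZeroDivisors A, IsUnit (g y) := by
    rintro ⟨y, hy⟩
    obtain ⟨Q, rfl⟩ := Ideal.Quotient.mk_surjective y
    refine IsUnit.of_mul_eq_one _ (hinv Q fun hQ => nonZeroDivisors.ne_zero hy ?_)
    rwa [hF, ← Ideal.Quotient.eq_zero_iff_mem] at hQ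
  let φ : PlaneFunctionField F →+* Germ (codiscrete S) ℂ := IsLocalization.lift hunit
  have hφ : ∀ P, φ (MvPolynomial.aeval (planeCoord F) P) = substitution v P := fun P => by
    rw [aeval_planeCoord]
    exact (IsLocalization.lift_eq hunit _).trans (hg P)
  refine ⟨⟨φ, fun c => ?_, fun k => ?_⟩, fun i => ?_⟩
  · have h := hφ (MvPolynomial.C c)
    rw [MvPolynomial.aeval_C, substitution_apply, MvPolynomial.aeval_C] at h
    exact h
  · obtain ⟨P, Q, hQ, rfl⟩ := exists_eq_aeval_div F k
    refine ⟨MvPolynomial.aeval v P * (MvPolynomial.aeval v Q)⁻¹,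
      (IsMeromorphic.aeval hv P).mul (IsMeromorphic.aeval hv Q).inv, ?_⟩
    have hQ' : Q ∉ relationIdeal v := by rwa [hF, Ideal.mem_span_singleton]
    have hne : MvPolynomial.aeval (planeCoord F) Q ≠ 0 := fun h =>
      hQ ((aeval_planeCoord_eq_zero_iff F Q).1 h)
    have h1 : φ (MvPolynomial.aeval (planeCoord F) P / MvPolynomial.aeval (planeCoord F) Q) *
        substitution v Q = substitution v P := by
      rw [← hφ Q, ← hφ P, ← map_mul, div_mul_cancel₀ _ hne]
    rw [Germ.coe_mul, ← substitution_apply, ← h1, mul_assoc, hinv Q hQ', mul_one]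
  · have h := hφ (MvPolynomial.X i)
    rw [MvPolynomial.aeval_X, substitution_apply, MvPolynomial.aeval_X] at h
    exact h

/-- The genus of a plane curve parametrized by nonconstant meromorphic functions on `S` is at most
the genus of `S`. -/
theorem planeCurveGenus_le [IsManifold 𝓘(ℂ) ω S] (hv : ∀ i, IsMeromorphic (v i))
    (hconst : ∀ i c, ¬ ∀ᶠ x in codiscrete S, v i x = c)
    {F : MvPolynomial (Fin 2) ℂ} (hF : Irreducible F) (hFv : F ∈ relationIdeal v) :
    Cardinal.lift (planeCurveGenus F hF) ≤ surfaceGenus S := by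
  have := span_singleton_isPrime hF
  have := isPrime_relationIdeal hv
  obtain ⟨φ, hφ⟩ := exists_meromorphicEmbedding hv
    (eq_span_singleton_of_irreducible_mem (not_isMaximal_relationIdeal (hconst 0)) hF hFv)
  obtain ⟨i, hi⟩ := exists_forall_eq_smul_D F hF
  -- Either `dx` or `dy` may be the spanning differential, so both coordinates must be nonconstant.
  have h := φ.lift_functionFieldGenus_le hi fun h0 => by
    rw [φ.derivation_apply, φ.formGerm_differential_congr (φ.rep_eventuallyEq (hφ i)),
      ← φ.formGerm_zero, φ.formGerm_eq_iff] at h0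
    obtain ⟨c, hc⟩ := (hv i).exists_eventually_eq_of_differential_eq_zero h0
    exact hconst i c hc
  rw [Cardinal.lift_id'.{0}] at h
  exact h

end Parametrization

/-! ### Holomorphic maps to the Riemann sphere -/

/-- The affine coordinate on the Riemann sphere, with the value `0` at `∞`. -/
def coord : RiemannSphere → ℂ
  | OnePoint.infty => 0
  | OnePoint.some z => z

@[simp] theorem coord_infty : coord OnePoint.infty = 0 := rfl

@[simp] theorem coord_coe (z : ℂ) : coord (z : RiemannSphere) = z := rfl

theorem coe_coord {p : RiemannSphere} (hp : p ≠ OnePoint.infty) :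
    ((coord p : ℂ) : RiemannSphere) = p := by
  induction p using OnePoint.rec with
  | infty => exact absurd rfl hp
  | coe z => rfl

theorem coord_sphereInv (p : RiemannSphere) : coord (sphereInv p) = (coord p)⁻¹ := by
  induction p using OnePoint.rec with
  | infty => simp
  | coe z =>
    by_cases hz : z = 0
    · simp [hz]
    · rw [sphereInv_coe_ne hz, coord_coe, coord_coe]

theorem sphereInv_injective : Function.Injective sphereInv :=
  Function.LeftInverse.injective sphereInv_sphereInv

theorem sphereInv_ne_infty {p : RiemannSphere} (hp : p ≠ ((0 : ℂ) : RiemannSphere)) :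
    sphereInv p ≠ OnePoint.infty := fun h =>
  hp (sphereInv_injective (h.trans sphereInv_zero.symm))

theorem mem_chartZero_source {p : RiemannSphere} (hp : p ≠ OnePoint.infty) :
    p ∈ chartZero.source := by
  rw [← coe_coord hp]
  exact ⟨_, trivial, rfl⟩

theorem chartZero_eq_coord {p : RiemannSphere} (hp : p ≠ OnePoint.infty) :
    chartZero p = coord p := by
  rw [← coe_coord hp, chartZero_coe, coord_coe]

theorem isOpen_ne_infty : IsOpen {p : RiemannSphere | p ≠ OnePoint.infty} := isOpen_ne

theorem mdifferentiableAt_coord {p : RiemannSphere} (hp : p ≠ OnePoint.infty) :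
    MDifferentiableAt 𝓘(ℂ) 𝓘(ℂ) coord p := by
  have h : MDifferentiableAt 𝓘(ℂ) 𝓘(ℂ) chartZero p :=
    mdifferentiableAt_atlas (by left; rfl) (mem_chartZero_source hp)
  refine h.congr_of_eventuallyEq ?_
  filter_upwards [isOpen_ne_infty.mem_nhds hp] with q hq
  exact (chartZero_eq_coord hq).symm

theorem mdifferentiable_coe : MDifferentiable 𝓘(ℂ) 𝓘(ℂ) ((↑) : ℂ → RiemannSphere) := fun z =>
  mdifferentiableAt_atlas_symm (e := chartZero) (by left; rfl) (Set.mem_univ z)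

/-- The inversion is `chartInfty` followed by the inclusion of `ℂ` near `∞`, and the affine
coordinate followed by `chartInfty.symm` elsewhere. -/
theorem mdifferentiable_sphereInv : MDifferentiable 𝓘(ℂ) 𝓘(ℂ) sphereInv := by
  intro p
  by_cases hp : p = OnePoint.infty
  · have hp0 : p ≠ ((0 : ℂ) : RiemannSphere) := by
      rw [hp]
      exact (OnePoint.coe_ne_infty 0).symm
    have h1 : MDifferentiableAt 𝓘(ℂ) 𝓘(ℂ) chartInfty p :=
      mdifferentiableAt_atlas (by right; rfl)
        ((mem_chartInfty_source p).2 (mem_chartZero_source (sphereInv_ne_infty hp0)))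
    refine ((mdifferentiable_coe _).comp p h1).congr_of_eventuallyEq ?_
    filter_upwards [isOpen_ne.mem_nhds hp0] with q hq
    rw [Function.comp_apply, chartInfty_apply, chartZero_eq_coord (sphereInv_ne_infty hq),
      coe_coord (sphereInv_ne_infty hq)]
  · have h1 := mdifferentiableAt_coord hp
    have h2 : MDifferentiableAt 𝓘(ℂ) 𝓘(ℂ) chartInfty.symm (coord p) :=
      mdifferentiableAt_atlas_symm (by right; rfl) (Set.mem_univ _)
    refine (h2.comp p h1).congr_of_eventuallyEq ?_
    filter_upwards [isOpen_ne.mem_nhds hp] with q hq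
    rw [Function.comp_apply, chartInfty_symm, coe_coord hq]

section Maps

variable {S : Type*} [TopologicalSpace S] [ChartedSpace ℂ S] [IsManifold 𝓘(ℂ) ω S]
  {U V : S → RiemannSphere}

theorem contMDiffAt_coord_comp (hU : MDifferentiable 𝓘(ℂ) 𝓘(ℂ) U) {s : S}
    (hs : U s ≠ OnePoint.infty) : ContMDiffAt 𝓘(ℂ) 𝓘(ℂ) ω (coord ∘ U) s := by
  refine ContMDiffAt.of_eventually_mdifferentiableAt ?_
  filter_upwards [(hU s).continuousAt.preimage_mem_nhds (isOpen_ne_infty.mem_nhds hs)] with x hx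
  exact (mdifferentiableAt_coord hx).comp x (hU x)

/-- At a point sent to `∞` the map `1 / U` is holomorphic in the affine coordinate. The values
`coord ∞ = 0` and `0⁻¹ = 0` make the inversion formula exact everywhere. -/
theorem isMeromorphic_coord_comp (hU : MDifferentiable 𝓘(ℂ) 𝓘(ℂ) U) :
    IsMeromorphic (coord ∘ U) := by
  intro s
  by_cases hs : U s = OnePoint.infty
  · have h1 : (sphereInv ∘ U) s ≠ OnePoint.infty := by
      simp [hs]
    have h2 := (contMDiffAt_iff_analyticAt.1 (contMDiffAt_coord_comp
      (mdifferentiable_sphereInv.comp hU) h1)).2.meromorphicAt.inv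
    refine h2.congr (Eventually.of_forall fun z => ?_)
    simp [coord_sphereInv]
  · exact (contMDiffAt_iff_analyticAt.1 (contMDiffAt_coord_comp hU hs)).2.meromorphicAt

theorem eventually_nhdsNE_eq_or_ne (hU : MDifferentiable 𝓘(ℂ) 𝓘(ℂ) U)
    (hV : MDifferentiable 𝓘(ℂ) 𝓘(ℂ) V) {s : S} (hs : U s ≠ OnePoint.infty) (hUV : U s = V s) :
    (∀ᶠ x in 𝓝[≠] s, U x = V x) ∨ ∀ᶠ x in 𝓝[≠] s, U x ≠ V x := by
  set g : S → ℂ := coord ∘ U + (fun _ => -1) * coord ∘ V with hg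
  have h := ((isMeromorphic_coord_comp hU).add ((IsMeromorphic.const (-1)).mul
    (isMeromorphic_coord_comp hV)) s).eventually_eq_zero_or_eventually_ne_zero
  have hfin : ∀ᶠ x in 𝓝[≠] s, U x ≠ OnePoint.infty ∧ V x ≠ OnePoint.infty :=
    nhdsWithin_le_nhds (((hU s).continuousAt.eventually_ne hs).and
      ((hV s).continuousAt.eventually_ne (hUV ▸ hs)))
  have heq : ∀ᶠ x in 𝓝[≠] s, (g x = 0 ↔ U x = V x) := by
    filter_upwards [hfin] with x hx
    rw [hg, Pi.add_apply, Pi.mul_apply, Function.comp_apply, Function.comp_apply, neg_one_mul,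
      ← sub_eq_add_neg, sub_eq_zero]
    refine ⟨fun h => ?_, fun h => by rw [h]⟩
    rw [← coe_coord hx.1, ← coe_coord hx.2, h]
  rcases h with h | h
  · left
    filter_upwards [(eventually_nhdsNE_chartAt_iff (p := fun x => g x = 0)).1 h, heq] with x hx hx'
    exact hx'.1 hx
  · right
    filter_upwards [(eventually_nhdsNE_chartAt_iff
      (p := fun x => g x ≠ 0)).1 h, heq] with x hx hx'
    exact fun h => hx (hx'.2 h)

/-- The identity principle for holomorphic maps to the Riemann sphere. -/
theorem eq_or_eventually_ne [T2Space S] [PreconnectedSpace S]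
    (hU : MDifferentiable 𝓘(ℂ) 𝓘(ℂ) U) (hV : MDifferentiable 𝓘(ℂ) 𝓘(ℂ) V) :
    U = V ∨ ∀ᶠ x in codiscrete S, U x ≠ V x := by
  have h : (∀ᶠ x in codiscrete S, U x = V x) ∨ ∀ᶠ x in codiscrete S, ¬ U x = V x := by
    refine eventually_codiscrete_or_of_forall nhdsNE_neBot fun s => ?_
    by_cases hs : U s = V s
    · by_cases hinf : U s = OnePoint.infty
      · have h1 := eventually_nhdsNE_eq_or_ne (mdifferentiable_sphereInv.comp hU)
          (mdifferentiable_sphereInv.comp hV) (s := s) (by simp [hinf]) (by simp [hs])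
        simpa only [Function.comp_apply, sphereInv_injective.eq_iff, ne_eq] using h1
      · exact eventually_nhdsNE_eq_or_ne hU hV hinf hs
    · right
      exact nhdsWithin_le_nhds (((hU s).continuousAt.prodMk (hV s).continuousAt).preimage_mem_nhds
        (isClosed_diagonal.isOpen_compl.mem_nhds hs))
  refine h.imp_left fun h => funext fun s => ?_
  have := nhdsNE_neBot s
  exact tendsto_nhds_unique_of_eventuallyEq ((hU s).continuousAt.mono_left nhdsWithin_le_nhds)
    ((hV s).continuousAt.mono_left nhdsWithin_le_nhds) (eventually_codiscrete_iff.1 h s)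

theorem eventually_ne_const [T2Space S] [PreconnectedSpace S]
    (hU : MDifferentiable 𝓘(ℂ) 𝓘(ℂ) U) (hc : ¬ ∃ c, ∀ x, U x = c) (c : RiemannSphere) :
    ∀ᶠ x in codiscrete S, U x ≠ c :=
  (eq_or_eventually_ne hU (V := fun _ => c) mdifferentiable_const).resolve_left
    fun h => hc ⟨c, congrFun h⟩

theorem not_eventually_coord_eq [T2Space S] [ConnectedSpace S]
    (hU : MDifferentiable 𝓘(ℂ) 𝓘(ℂ) U) (hc : ¬ ∃ c, ∀ x, U x = c) (c : ℂ) :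
    ¬ ∀ᶠ x in codiscrete S, coord (U x) = c := by
  intro h
  have := codiscrete_neBot (S := S)
  obtain ⟨x, h1, h2, h3⟩ := (h.and ((eventually_ne_const hU hc c).and
    (eventually_ne_const hU hc OnePoint.infty))).exists
  exact h2 (by rw [← coe_coord h3, h1])

end Maps

/-! ### The curve `A(x) = A(y)` -/

section DifferenceCurve

open MvPolynomial

/-- Fixing `y` with `q(y) ≠ 0` would give `p(x) q(y) = p(y) q(x)`, so `q` divides `p`. By
coprimality `q`, and then `p`, would be constant. Being nonzero, the polynomial has a factorization
into irreducibles. -/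
theorem differenceCurve_ne_zero {A : RatFunc ℂ} (hA : 2 ≤ ratDegree A) :
    differenceCurve A ≠ 0 := by
  intro h
  have hd := A.denom_ne_zero
  obtain ⟨y, hy⟩ := Polynomial.exists_eval_ne_zero_of_natDegree_lt_card A.denom hd
    (lt_of_lt_of_le (Cardinal.natCast_lt_aleph0) (Cardinal.aleph0_le_mk ℂ))
  have h1 : A.num * Polynomial.C (A.denom.eval y) = Polynomial.C (A.num.eval y) * A.denom := by
    have hC : ∀ p : Polynomial ℂ, Polynomial.aeval (Polynomial.C y) p =
        Polynomial.C (p.eval y) := fun p => by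
      rw [← Polynomial.algebraMap_eq, Polynomial.aeval_algebraMap_apply,
        Polynomial.coe_aeval_eq_eval]
    have h2 := congrArg (aeval ![(Polynomial.X : Polynomial ℂ), Polynomial.C y]) h
    simp only [differenceCurve, map_sub, map_mul, map_zero, sub_eq_zero,
      ← Polynomial.aeval_algHom_apply, aeval_X, Matrix.cons_val_zero, Matrix.cons_val_one,
      Polynomial.aeval_X_left_apply, hC] at h2
    exact h2
  have hu : IsUnit (A.denom.eval y) := isUnit_iff_ne_zero.2 hy
  have h3 : A.denom ∣ A.num * Polynomial.C (A.denom.eval y) := h1 ▸ dvd_mul_left _ _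
  have h4 : A.denom ∣ A.num := (hu.map Polynomial.C).dvd_mul_right.1 h3
  have h5 : IsUnit A.denom := A.isCoprime_num_denom.symm.isUnit_of_dvd' dvd_rfl h4
  have h6 : A.denom.natDegree = 0 := Polynomial.natDegree_eq_zero_of_isUnit h5
  have h7 := congrArg Polynomial.natDegree h1
  rw [Polynomial.natDegree_mul_C hy] at h7
  have h8 := Polynomial.natDegree_C_mul_le (A.num.eval y) A.denom
  unfold ratDegree at hA
  omega

theorem aeval_differenceCurve_eq_zero (A : RatFunc ℂ) {x y : ℂ}
    (h : ratMap A (x : RiemannSphere) = ratMap A (y : RiemannSphere)) :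
    aeval ![x, y] (differenceCurve A) = 0 := by
  have h1 : ∀ z : ℂ, ratMap A (z : RiemannSphere) = if A.denom.eval z = 0 then OnePoint.infty
      else ((A.num.eval z / A.denom.eval z : ℂ) : RiemannSphere) := fun z => rfl
  simp only [differenceCurve, map_sub, map_mul, ← Polynomial.aeval_algHom_apply, aeval_X,
    Matrix.cons_val_zero, Matrix.cons_val_one, Polynomial.coe_aeval_eq_eval]
  rw [h1, h1] at h
  split_ifs at h with hx hy hy
  · rw [hx, hy, mul_zero, mul_zero, sub_zero]
  · exact absurd h (OnePoint.coe_ne_infty _).symm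
  · exact absurd h (OnePoint.coe_ne_infty _)
  · have h2 := OnePoint.coe_injective h
    rw [div_eq_div_iff hx hy] at h2
    rw [h2, sub_self]

theorem aeval_apply_pi {X : Type*} (v : Fin 2 → X → ℂ) (P : MvPolynomial (Fin 2) ℂ) (x : X) :
    aeval v P x = aeval ![v 0 x, v 1 x] P := by
  have h := congrFun (congrArg DFunLike.coe (MvPolynomial.algHom_ext (f := (Pi.evalAlgHom ℂ
    (fun _ : X => ℂ) x).comp (aeval v)) (g := aeval ![v 0 x, v 1 x]) fun i => by
      fin_cases i <;> simp)) P
  exact h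

/-- Two distinct nonconstant holomorphic maps `U`, `V` with `A ∘ U = A ∘ V` on a surface of genus
zero or one force `A` to be wild. -/
theorem isWild_of_ratMap_comp_eq {A : RatFunc ℂ} (hA : 2 ≤ ratDegree A)
    {S : Type*} [TopologicalSpace S] [T2Space S] [ConnectedSpace S]
    [ChartedSpace ℂ S] [IsManifold 𝓘(ℂ) ω S]
    (hS : surfaceGenus S = 0 ∨ surfaceGenus S = 1) {U V : S → RiemannSphere}
    (hU : MDifferentiable 𝓘(ℂ) 𝓘(ℂ) U) (hV : MDifferentiable 𝓘(ℂ) 𝓘(ℂ) V)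
    (hUc : ¬ ∃ c, ∀ x, U x = c) (hVc : ¬ ∃ c, ∀ x, V x = c) (hUV : U ≠ V)
    (h : ratMap A ∘ U = ratMap A ∘ V) : IsWild A := by
  set v : Fin 2 → S → ℂ := ![coord ∘ U, coord ∘ V]
  have hv : ∀ i, IsMeromorphic (v i) := by
    intro i
    fin_cases i
    · exact isMeromorphic_coord_comp hU
    · exact isMeromorphic_coord_comp hV
  have hconst : ∀ i c, ¬ ∀ᶠ x in codiscrete S, v i x = c := by
    intro i
    fin_cases i
    · exact not_eventually_coord_eq hU hUc
    · exact not_eventually_coord_eq hV hVc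
  have hfin := (eventually_ne_const hU hUc OnePoint.infty).and
    (eventually_ne_const hV hVc OnePoint.infty)
  have hmem : differenceCurve A ∈ relationIdeal v := by
    rw [mem_relationIdeal]
    filter_upwards [hfin] with x hx
    rw [aeval_apply_pi]
    refine aeval_differenceCurve_eq_zero A ?_
    change ratMap A ((coord (U x) : ℂ) : RiemannSphere) =
      ratMap A ((coord (V x) : ℂ) : RiemannSphere)
    rw [coe_coord hx.1, coe_coord hx.2]
    exact congrFun h x
  have hprime := isPrime_relationIdeal hv
  obtain ⟨F, hF, hFA, hFv⟩ : ∃ F, Irreducible F ∧ F ∣ differenceCurve A ∧ F ∈ relationIdeal v := by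
    obtain ⟨f, hf, u, hu⟩ := WfDvdMonoid.exists_factors _ (differenceCurve_ne_zero hA)
    have h1 : f.prod ∈ relationIdeal v := by
      rw [← hu] at hmem
      -- The unit of the factorization cannot lie in a prime ideal, so some irreducible factor does.
      exact (hprime.mem_or_mem hmem).resolve_right fun h2 =>
        hprime.ne_top (Ideal.eq_top_of_isUnit_mem _ h2 u.isUnit)
    obtain ⟨F, hFf, hFv⟩ := (hprime.multiset_prod_mem_iff_exists_mem f).1 h1
    exact ⟨F, hf F hFf, (Multiset.dvd_prod hFf).trans ⟨u, hu.symm⟩, hFv⟩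
  rw [IsWild, IsTame, not_not]
  refine ⟨F, hF, hFA, fun hdiag => ?_, ?_⟩
  · have h1 : (X 0 - X 1 : MvPolynomial (Fin 2) ℂ) ∈ relationIdeal v :=
      (Ideal.mem_iff_of_associated hdiag).1 hFv
    rw [mem_relationIdeal] at h1
    have := codiscrete_neBot (S := S)
    obtain ⟨x, hx1, hx2, hx3⟩ := (h1.and (hfin.and
      ((eq_or_eventually_ne hU hV).resolve_left hUV))).exists
    refine hx3 ?_
    rw [map_sub, aeval_X, aeval_X, Pi.sub_apply, sub_eq_zero] at hx1
    rw [← coe_coord hx2.1, ← coe_coord hx2.2]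
    exact congrArg _ hx1
  · have h1 : Cardinal.lift (planeCurveGenus F hF) ≤ 1 :=
      (planeCurveGenus_le hv hconst hF hFv).trans (by rcases hS with h | h <;> simp [h])
    rw [Cardinal.lift_le_one_iff] at h1
    rcases lt_or_eq_of_le h1 with h2 | h2
    · left
      exact Cardinal.lt_one_iff.1 h2
    · right
      exact h2

end DifferenceCurve

/-! ### Holomorphic self-maps of the Riemann sphere are rational -/

open Classical in
/-- The quotient of two functions, with values in the Riemann sphere. -/
def sphereDiv (a b : ℂ) : RiemannSphere :=
  if b = 0 then OnePoint.infty else ((a / b : ℂ) : RiemannSphere)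

theorem sphereDiv_of_ne_zero {a b : ℂ} (hb : b ≠ 0) :
    sphereDiv a b = ((a / b : ℂ) : RiemannSphere) := if_neg hb

theorem sphereDiv_zero (a : ℂ) : sphereDiv a 0 = OnePoint.infty := if_pos rfl

theorem sphereInv_sphereDiv {a b : ℂ} (ha : a ≠ 0) :
    sphereInv (sphereDiv a b) = sphereDiv b a := by
  by_cases hb : b = 0
  · rw [hb, sphereDiv_zero, sphereDiv_of_ne_zero ha, zero_div, sphereInv_infty]
  · rw [sphereDiv_of_ne_zero hb, sphereDiv_of_ne_zero ha, sphereInv_coe_ne (div_ne_zero ha hb),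
      inv_div]

theorem sphereDiv_mul_right (a b : ℂ) {c : ℂ} (hc : c ≠ 0) :
    sphereDiv (a * c) (b * c) = sphereDiv a b := by
  by_cases hb : b = 0
  · rw [hb, zero_mul, sphereDiv_zero, sphereDiv_zero]
  · rw [sphereDiv_of_ne_zero hb, sphereDiv_of_ne_zero (mul_ne_zero hb hc), mul_div_mul_right _ _ hc]

theorem continuousAt_sphereDiv_of_ne_zero {X : Type*} [TopologicalSpace X] {a b : X → ℂ} {x : X}
    (ha : ContinuousAt a x) (hb : ContinuousAt b x) (h : b x ≠ 0) :
    ContinuousAt (fun y => sphereDiv (a y) (b y)) x := by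
  have h1 : ContinuousAt (fun y => ((a y / b y : ℂ) : RiemannSphere)) x :=
    OnePoint.continuous_coe.continuousAt.comp (ha.div hb h)
  refine h1.congr ?_
  filter_upwards [hb.eventually_ne h] with y hy
  exact (sphereDiv_of_ne_zero hy).symm

theorem continuousAt_sphereDiv {X : Type*} [TopologicalSpace X] {a b : X → ℂ} {x : X}
    (ha : ContinuousAt a x) (hb : ContinuousAt b x) (h : a x ≠ 0 ∨ b x ≠ 0) :
    ContinuousAt (fun y => sphereDiv (a y) (b y)) x := by
  rcases h with h | h
  · have h1 : ContinuousAt (fun y => sphereInv (sphereDiv (b y) (a y))) x :=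
      continuous_sphereInv.continuousAt.comp (continuousAt_sphereDiv_of_ne_zero hb ha h)
    refine h1.congr ?_
    filter_upwards [ha.eventually_ne h] with y hy
    rw [← sphereInv_sphereDiv hy, sphereInv_sphereInv]
  · exact continuousAt_sphereDiv_of_ne_zero ha hb h

theorem ratMap_coe (A : RatFunc ℂ) (z : ℂ) :
    ratMap A (z : RiemannSphere) = sphereDiv (A.num.eval z) (A.denom.eval z) := rfl

/-- Multiplying numerator and denominator of `A(1/w)` by `w` to the degree of `A` gives the reversed
polynomials. Reflecting both in the same degree lets the common power cancel and covers `w = 0` as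
well. -/
theorem ratMap_sphereInv_coe (A : RatFunc ℂ) (w : ℂ) :
    ratMap A (sphereInv (w : RiemannSphere)) =
      sphereDiv ((A.num.reflect (ratDegree A)).eval w) ((A.denom.reflect (ratDegree A)).eval w) := by
  by_cases hw : w = 0
  · rw [hw, sphereInv_zero, ← Polynomial.coeff_zero_eq_eval_zero,
      ← Polynomial.coeff_zero_eq_eval_zero, Polynomial.coeff_reflect, Polynomial.coeff_reflect,
      Polynomial.revAt_le (Nat.zero_le _), Nat.sub_zero]
    have h1 : ratMap A OnePoint.infty = if A.denom.natDegree < A.num.natDegree then OnePoint.infty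
      else ((A.num.coeff A.denom.natDegree / A.denom.leadingCoeff : ℂ) : RiemannSphere) := rfl
    rw [h1]
    split_ifs with h
    · rw [ratDegree, max_eq_left h.le, Polynomial.coeff_eq_zero_of_natDegree_lt h, sphereDiv_zero]
    · rw [ratDegree, max_eq_right (not_lt.1 h)]
      exact (sphereDiv_of_ne_zero (Polynomial.leadingCoeff_ne_zero.2 A.denom_ne_zero)).symm
  · have hrefl : ∀ p : Polynomial ℂ, p.natDegree ≤ ratDegree A →
        p.eval w⁻¹ * w ^ ratDegree A = (p.reflect (ratDegree A)).eval w := by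
      intro p hp
      let _ : Invertible w⁻¹ := invertibleOfNonzero (inv_ne_zero hw)
      have h := Polynomial.eval₂_reflect_mul_pow (RingHom.id ℂ) w⁻¹ (ratDegree A) p hp
      rw [invOf_eq_inv, inv_inv, Polynomial.eval₂_id, Polynomial.eval₂_id] at h
      rw [← h, mul_assoc, ← mul_pow, inv_mul_cancel₀ hw, one_pow, mul_one]
    rw [sphereInv_coe_ne hw, ratMap_coe, ← hrefl _ (le_max_left _ _), ← hrefl _ (le_max_right _ _),
      sphereDiv_mul_right _ _ (pow_ne_zero _ hw)]

theorem num_eval_ne_zero_or (A : RatFunc ℂ) (z : ℂ) : A.num.eval z ≠ 0 ∨ A.denom.eval z ≠ 0 := by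
  by_contra! h
  obtain ⟨a, b, hab⟩ := A.isCoprime_num_denom
  have := congrArg (Polynomial.eval z) hab
  simp [h.1, h.2] at this

theorem continuous_ratMap (A : RatFunc ℂ) : Continuous (ratMap A) := by
  rw [continuous_iff_continuousAt]
  intro p
  induction p using OnePoint.rec with
  | coe z =>
    rw [OnePoint.continuousAt_coe]
    exact continuousAt_sphereDiv A.num.continuousAt A.denom.continuousAt (num_eval_ne_zero_or A z)
  | infty =>
    have h1 : ContinuousAt (ratMap A ∘ sphereInv) ((0 : ℂ) : RiemannSphere) := by
      rw [OnePoint.continuousAt_coe]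
      refine ContinuousAt.congr (f := fun w => sphereDiv ((A.num.reflect (ratDegree A)).eval w)
        ((A.denom.reflect (ratDegree A)).eval w)) (continuousAt_sphereDiv
          (Polynomial.continuousAt _) (Polynomial.continuousAt _) ?_)
        (Eventually.of_forall fun w => (ratMap_sphereInv_coe A w).symm)
      rw [← Polynomial.coeff_zero_eq_eval_zero, ← Polynomial.coeff_zero_eq_eval_zero,
        Polynomial.coeff_reflect, Polynomial.coeff_reflect, Polynomial.revAt_le (Nat.zero_le _),
        Nat.sub_zero]
      -- At `w = 0` the reflected polynomial of larger original degree takes its leading coefficient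
      -- as value, so the two do not both vanish.
      rcases le_or_gt A.num.natDegree A.denom.natDegree with h | h
      · right
        rw [ratDegree, max_eq_right h]
        exact Polynomial.leadingCoeff_ne_zero.2 A.denom_ne_zero
      · left
        rw [ratDegree, max_eq_left h.le]
        exact Polynomial.leadingCoeff_ne_zero.2 (Polynomial.ne_zero_of_natDegree_gt h)
    have h2 : ContinuousAt ((ratMap A ∘ sphereInv) ∘ sphereInv) OnePoint.infty :=
      ContinuousAt.comp (by simpa using h1) continuous_sphereInv.continuousAt
    refine h2.congr (Eventually.of_forall fun q => ?_)
    simp [sphereInv_sphereInv]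

theorem ratMap_div_coe (P : Polynomial ℂ) {Q : Polynomial ℂ} {z : ℂ} (hz : Q.eval z ≠ 0) :
    ratMap (algebraMap _ (RatFunc ℂ) P / algebraMap _ (RatFunc ℂ) Q) (z : RiemannSphere) =
      ((P.eval z / Q.eval z : ℂ) : RiemannSphere) := by
  set T := algebraMap _ (RatFunc ℂ) P / algebraMap _ (RatFunc ℂ) Q with hT
  have hQ : Q ≠ 0 := fun h => hz (by rw [h, Polynomial.eval_zero])
  have hd : T.denom.eval z ≠ 0 := fun h => hz <| by
    obtain ⟨D, hD⟩ := RatFunc.denom_div_dvd P Q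
    rw [hD, Polynomial.eval_mul, ← hT, h, zero_mul]
  have h1 : T.num * Q = P * T.denom := by
    have h2 := T.num_div_denom
    rw [hT, div_eq_div_iff (RatFunc.algebraMap_ne_zero T.denom_ne_zero)
      (RatFunc.algebraMap_ne_zero hQ), ← map_mul, ← map_mul] at h2
    exact RatFunc.algebraMap_injective ℂ h2
  rw [ratMap_coe, sphereDiv_of_ne_zero hd]
  congr 1
  rw [div_eq_div_iff hd hz, ← Polynomial.eval_mul, ← Polynomial.eval_mul, h1]

theorem ratMap_C (c : ℂ) (p : RiemannSphere) : ratMap (RatFunc.C c) p = (c : RiemannSphere) := by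
  induction p using OnePoint.rec with
  | infty => simp [ratMap]
  | coe z => rw [ratMap_coe, sphereDiv_of_ne_zero (by simp)]; simp

theorem chartAt_coe (z : ℂ) : chartAt ℂ (z : RiemannSphere) = chartZero :=
  if_neg (OnePoint.coe_ne_infty z)

theorem chartAt_infty : chartAt ℂ (OnePoint.infty : RiemannSphere) = chartInfty := if_pos rfl

theorem chartInfty_infty : chartInfty OnePoint.infty = 0 := by
  rw [chartInfty_apply, sphereInv_infty, chartZero_coe]

theorem eventually_nhdsNE_coe {p : RiemannSphere → Prop} (h : ∀ᶠ q in codiscrete _, p q) (z : ℂ) :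
    ∀ᶠ w : ℂ in 𝓝[≠] z, p (w : RiemannSphere) := by
  have h1 := eventually_nhdsNE_chartAt_iff.2
    (eventually_codiscrete_iff.1 h (z : RiemannSphere))
  rwa [chartAt_coe, chartZero_coe] at h1

theorem eventually_nhdsNE_inv {p : RiemannSphere → Prop} (h : ∀ᶠ q in codiscrete _, p q) :
    ∀ᶠ w : ℂ in 𝓝[≠] 0, p (sphereInv (w : RiemannSphere)) := by
  have h1 := eventually_nhdsNE_chartAt_iff.2
    (eventually_codiscrete_iff.1 h OnePoint.infty)
  rwa [chartAt_infty, chartInfty_infty] at h1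

theorem IsMeromorphic.meromorphicAt_coe {f : RiemannSphere → ℂ} (hf : IsMeromorphic f) (z : ℂ) :
    MeromorphicAt (fun w : ℂ => f (w : RiemannSphere)) z := by
  have h := hf (z : RiemannSphere)
  rwa [chartAt_coe, chartZero_coe] at h

theorem IsMeromorphic.meromorphicAt_inv {f : RiemannSphere → ℂ} (hf : IsMeromorphic f) :
    MeromorphicAt (fun w : ℂ => f (sphereInv (w : RiemannSphere))) 0 := by
  have h := hf OnePoint.infty
  rwa [chartAt_infty, chartInfty_infty] at h

/-- An entire function without zeros that is meromorphic at infinity is constant. -/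
theorem exists_eq_const_of_meromorphicAt_inv {g k : ℂ → ℂ} (hg : Differentiable ℂ g)
    (hg0 : ∀ z, g z ≠ 0) (hk : MeromorphicAt k 0) (hgk : ∀ᶠ w in 𝓝[≠] 0, k w = g w⁻¹) :
    ∃ c, ∀ z, g z = c := by
  -- Nonnegative order at `0` gives `g` a finite limit at infinity, and Liouville's theorem applies.
  -- Otherwise the same is used for `1 / g`, which is entire because `g` has no zeros.
  have key : ∀ {g k : ℂ → ℂ}, Differentiable ℂ g → MeromorphicAt k 0 →
      (∀ᶠ w in 𝓝[≠] 0, k w = g w⁻¹) → 0 ≤ meromorphicOrderAt k 0 → ∃ c, ∀ z, g z = c := by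
    intro g k hg hk hgk h0
    obtain ⟨c, hc⟩ := tendsto_nhds_of_meromorphicOrderAt_nonneg hk h0
    refine ⟨c, fun z => hg.apply_eq_of_tendsto_cocompact z ?_⟩
    rw [← Metric.cobounded_eq_cocompact]
    have h1 := (hc.congr' hgk).comp (tendsto_inv₀_cobounded' (α := ℂ))
    simpa [Function.comp_def] using h1
  rcases le_total 0 (meromorphicOrderAt k 0) with h | h
  · exact key hg hk hgk h
  · have h1 : 0 ≤ meromorphicOrderAt k⁻¹ 0 := by
      rw [meromorphicOrderAt_inv]
      generalize meromorphicOrderAt k 0 = n at h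
      cases n with
      | top => exact le_top
      | coe n => exact_mod_cast neg_nonneg.2 (by exact_mod_cast h)
    obtain ⟨c, hc⟩ := key (g := g⁻¹) (hg.inv hg0) hk.inv
      (by filter_upwards [hgk] with w hw; simp [hw]) h1
    exact ⟨c⁻¹, fun z => by rw [← hc z, Pi.inv_apply, inv_inv]⟩

/-- Compactness leaves only finitely many zeros and poles. Dividing by the matching product of
powers `(z - u) ^ d u` leaves a zero-free entire function that is meromorphic at infinity, hence a
constant. -/
theorem exists_eq_ratMap_of_mdifferentiable {R : RiemannSphere → RiemannSphere}
    (hR : MDifferentiable 𝓘(ℂ) 𝓘(ℂ) R) (hc : ¬ ∃ c, ∀ p, R p = c) : ∃ T, R = ratMap T := by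
  have hgood : ∀ᶠ p in codiscrete RiemannSphere,
      R p ≠ ((0 : ℂ) : RiemannSphere) ∧ R p ≠ OnePoint.infty :=
    (eventually_ne_const hR hc _).and (eventually_ne_const hR hc _)
  have hmer := isMeromorphic_coord_comp hR
  set f : ℂ → ℂ := fun z => coord (R (z : RiemannSphere)) with hf
  have hfmer : MeromorphicOn f Set.univ := fun z _ => hmer.meromorphicAt_coe z
  have hne : ∀ {p}, R p ≠ ((0 : ℂ) : RiemannSphere) → R p ≠ OnePoint.infty → coord (R p) ≠ 0 := by
    intro p h1 h2 h3
    exact h1 (by rw [← coe_coord h2, h3])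
  have hfan : ∀ {z : ℂ}, R z ≠ OnePoint.infty → AnalyticAt ℂ f z := by
    intro z hz
    have h := (contMDiffAt_iff_analyticAt.1 (contMDiffAt_coord_comp hR hz)).2
    rwa [chartAt_coe, chartZero_coe] at h
  have htop : ∀ u : (Set.univ : Set ℂ), meromorphicOrderAt f u ≠ ⊤ := by
    rintro ⟨z, hz⟩
    rw [meromorphicOrderAt_ne_top_iff_eventually_ne_zero (hfmer z hz)]
    filter_upwards [eventually_nhdsNE_coe hgood z] with w hw
    exact hne hw.1 hw.2
  set d := MeromorphicOn.divisor f Set.univ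
  have hd0 : ∀ {z : ℂ}, R z ≠ ((0 : ℂ) : RiemannSphere) → R z ≠ OnePoint.infty → d z = 0 := by
    intro z h1 h2
    rw [MeromorphicOn.divisor_apply hfmer (Set.mem_univ z), (hfan h2).meromorphicOrderAt_eq,
      (hfan h2).analyticOrderAt_eq_zero.2 (hne h1 h2)]
    rfl
  have hfin : d.support.Finite := by
    -- On the compact sphere a codiscrete set has finite complement, so the divisor has finite
    -- support.
    rw [codiscrete_eq_cofinite] at hgood
    have h1 := hgood.preimage (f := ((↑) : ℂ → RiemannSphere)) OnePoint.coe_injective.injOn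
    refine h1.subset fun z hz hz' => hz (hd0 hz'.1 hz'.2)
  obtain ⟨g, hg, hg0, hfg⟩ := hfmer.extract_zeros_poles htop hfin
  set s := hfin.toFinset
  set φ : ℂ → ℂ := fun z => ∏ u ∈ s, (z - u) ^ d u
  have hφ : (∏ᶠ u, (fun z : ℂ => z - u) ^ d u) = φ := by
    rw [finprod_eq_prod_of_mulSupport_subset (s := s)]
    · ext z
      simp [φ]
    · intro u hu
      simp only [s, Set.Finite.coe_toFinset, Function.mem_support]
      rintro h0
      exact hu (by simp [h0])
  have hs : ∀ {z : ℂ}, R z ≠ ((0 : ℂ) : RiemannSphere) → R z ≠ OnePoint.infty →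
      ∀ u ∈ s, z - u ≠ 0 := by
    intro z h1 h2 u hu h
    rw [sub_eq_zero] at h
    subst h
    exact (hfin.mem_toFinset.1 hu) (hd0 h1 h2)
  have hfg' : ∀ z : ℂ, R z ≠ ((0 : ℂ) : RiemannSphere) → R z ≠ OnePoint.infty →
      f z = φ z * g z := by
    intro z h1 h2
    have h3 : ContinuousAt (fun w => φ w * g w) z :=
      (tendsto_finsetProd _ fun u hu => ((continuousAt_id.sub continuousAt_const).zpow₀ _
        (Or.inl (hs h1 h2 u hu)))).mul (hg z (Set.mem_univ z)).continuousAt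
    refine tendsto_nhds_unique_of_eventuallyEq (l := 𝓝[≠] z)
      ((hfan h2).continuousAt.mono_left nhdsWithin_le_nhds)
      (h3.mono_left nhdsWithin_le_nhds) ?_
    filter_upwards [eventually_codiscrete_iff.1 hfg z] with w hw
    rw [hw, hφ]
    rfl
  have hφ0 : ∀ {z : ℂ}, R z ≠ ((0 : ℂ) : RiemannSphere) → R z ≠ OnePoint.infty → φ z ≠ 0 :=
    fun h1 h2 => Finset.prod_ne_zero_iff.2 fun u hu => zpow_ne_zero _ (hs h1 h2 u hu)
  obtain ⟨c, hgc⟩ := exists_eq_const_of_meromorphicAt_inv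
    (g := g) (k := fun w => coord (R (sphereInv (w : RiemannSphere))) * (φ w⁻¹)⁻¹)
    (fun z => (hg z (Set.mem_univ z)).differentiableAt) (fun z => hg0 ⟨z, Set.mem_univ z⟩)
    (hmer.meromorphicAt_inv.mul (MeromorphicAt.inv (f := fun w => φ w⁻¹)
      (MeromorphicAt.fun_prod fun u _ => (((MeromorphicAt.id 0).inv).sub
        (MeromorphicAt.const u 0)).zpow _))) (by
      filter_upwards [eventually_nhdsNE_inv hgood, self_mem_nhdsWithin] with w hw hw0
      rw [sphereInv_coe_ne hw0] at hw ⊢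
      change f w⁻¹ * _ = _
      rw [hfg' _ hw.1 hw.2, mul_comm (φ _), mul_assoc, mul_inv_cancel₀ (hφ0 hw.1 hw.2), mul_one])
  -- `toNat` of `d u` and of `-d u` separates zeros from poles; one of the two is always `0`.
  set P : Polynomial ℂ := Polynomial.C c *
    ∏ u ∈ s, (Polynomial.X - Polynomial.C u) ^ (d u).toNat
  set Q : Polynomial ℂ := ∏ u ∈ s, (Polynomial.X - Polynomial.C u) ^ (-d u).toNat
  refine ⟨algebraMap _ _ P / algebraMap _ _ Q, ?_⟩
  have heq : ∀ᶠ p in codiscrete RiemannSphere,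
      R p = ratMap (algebraMap _ (RatFunc ℂ) P / algebraMap _ (RatFunc ℂ) Q) p := by
    have hinf : ∀ᶠ p in codiscrete RiemannSphere, p ≠ OnePoint.infty :=
      (Set.finite_singleton _).compl_mem_codiscrete
    filter_upwards [hgood, hinf] with p hp hpinf
    obtain ⟨z, rfl⟩ : ∃ z : ℂ, (z : RiemannSphere) = p := ⟨_, coe_coord hpinf⟩
    have hQ : Q.eval z = ∏ u ∈ s, (z - u) ^ (-d u).toNat := by
      simp [Q, Polynomial.eval_prod]
    have hP : P.eval z = c * ∏ u ∈ s, (z - u) ^ (d u).toNat := by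
      simp [P, Polynomial.eval_prod]
    have hQ0 : Q.eval z ≠ 0 := by
      rw [hQ]
      exact Finset.prod_ne_zero_iff.2 fun u hu => pow_ne_zero _ (hs hp.1 hp.2 u hu)
    rw [ratMap_div_coe P hQ0, ← coe_coord hp.2]
    congr 1
    change f z = _
    rw [hfg' z hp.1 hp.2, hgc, hP, hQ, mul_comm, mul_div_assoc, ← Finset.prod_div_distrib]
    congr 1
    refine Finset.prod_congr rfl fun u hu => ?_
    rw [← zpow_natCast, ← zpow_natCast, ← zpow_sub₀ (hs hp.1 hp.2 u hu)]
    congr 1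
    omega
  funext p
  have := nhdsNE_neBot p
  exact tendsto_nhds_unique_of_eventuallyEq ((hR p).continuousAt.mono_left nhdsWithin_le_nhds)
    ((continuous_ratMap _).continuousAt.mono_left nhdsWithin_le_nhds)
    (eventually_codiscrete_iff.1 heq p)

/-! ### Descent along a Galois covering -/

section Descent

variable {S : Type*} [TopologicalSpace S] [T2Space S] [ConnectedSpace S] [ChartedSpace ℂ S]
  [IsManifold 𝓘(ℂ) ω S] {Ψ : S → RiemannSphere}

theorem not_const_sphereInv_comp {X : Type*} {f : X → RiemannSphere} (hf : ¬ ∃ c, ∀ x, f x = c) :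
    ¬ ∃ c, ∀ x, (sphereInv ∘ f) x = c := by
  rintro ⟨c, hc⟩
  exact hf ⟨sphereInv c, fun x => by rw [← hc x, Function.comp_apply, sphereInv_sphereInv]⟩

theorem not_eventually_coord_comp_chart_eq (hΨ : MDifferentiable 𝓘(ℂ) 𝓘(ℂ) Ψ)
    (hc : ¬ ∃ c, ∀ x, Ψ x = c) {s : S} (c : ℂ) :
    ¬ ∀ᶠ z in 𝓝[≠] (chartAt ℂ s s), (coord ∘ Ψ ∘ (chartAt ℂ s).symm) z = c := by
  intro h
  have := nhdsNE_neBot s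
  have h1 := (eventually_nhdsNE_chartAt_iff (p := fun x => coord (Ψ x) = c)).1 h
  obtain ⟨x, hx1, hx2, hx3⟩ := (h1.and
    (((eventually_codiscrete_iff.1 (eventually_ne_const hΨ hc c)) s).and
    ((eventually_codiscrete_iff.1 (eventually_ne_const hΨ hc OnePoint.infty)) s))).exists
  exact hx2 (by rw [← coe_coord hx3, hx1])

theorem nhds_le_map_chart (hΨ : MDifferentiable 𝓘(ℂ) 𝓘(ℂ) Ψ) (hc : ¬ ∃ c, ∀ x, Ψ x = c) {s : S}
    (hs : Ψ s ≠ OnePoint.infty) :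
    𝓝 (coord (Ψ s)) ≤
      map (coord ∘ Ψ ∘ (chartAt ℂ s).symm) (𝓝 (chartAt ℂ s s)) := by
  have h := (contMDiffAt_iff_analyticAt.1
    (contMDiffAt_coord_comp hΨ hs)).2.eventually_constant_or_nhds_le_map_nhds
  have hval : ((coord ∘ Ψ) ∘ (chartAt ℂ s).symm) (chartAt ℂ s s) = coord (Ψ s) := by
    simp [(chartAt ℂ s).left_inv (mem_chart_source ℂ s)]
  rw [hval] at h
  exact h.resolve_left fun h => not_eventually_coord_comp_chart_eq hΨ hc _ (nhdsWithin_le_nhds h)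

theorem nhds_le_map_of_ne_infty (hΨ : MDifferentiable 𝓘(ℂ) 𝓘(ℂ) Ψ) (hc : ¬ ∃ c, ∀ x, Ψ x = c)
    {s : S} (hs : Ψ s ≠ OnePoint.infty) : 𝓝 (Ψ s) ≤ map Ψ (𝓝 s) := by
  have h := nhds_le_map_chart hΨ hc hs
  have h1 : map (coord ∘ Ψ ∘ (chartAt ℂ s).symm) (𝓝 (chartAt ℂ s s)) = map (coord ∘ Ψ) (𝓝 s) := by
    rw [← (chartAt ℂ s).symm_map_nhds_eq (mem_chart_source ℂ s), map_map]
    rfl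
  rw [h1] at h
  calc 𝓝 (Ψ s) = map ((↑) : ℂ → RiemannSphere) (𝓝 (coord (Ψ s))) := by
        rw [OnePoint.isOpenEmbedding_coe.map_nhds_eq, coe_coord hs]
    _ ≤ map ((↑) : ℂ → RiemannSphere) (map (coord ∘ Ψ) (𝓝 s)) := map_mono h
    _ = map Ψ (𝓝 s) := by
        rw [map_map]
        refine map_congr ?_
        filter_upwards [(hΨ s).continuousAt.eventually_ne hs] with x hx
        exact coe_coord hx

/-- The open mapping theorem in charts gives this at finite values; at poles it is applied to `1 /
Ψ`. -/
theorem isOpenMap_of_mdifferentiable (hΨ : MDifferentiable 𝓘(ℂ) 𝓘(ℂ) Ψ)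
    (hc : ¬ ∃ c, ∀ x, Ψ x = c) : IsOpenMap Ψ := by
  refine IsOpenMap.of_nhds_le fun s => ?_
  by_cases hs : Ψ s = OnePoint.infty
  · have h := map_mono (m := sphereInv) (nhds_le_map_of_ne_infty
      (mdifferentiable_sphereInv.comp hΨ) (not_const_sphereInv_comp hc) (s := s) (by simp [hs]))
    have h1 : map sphereInv (𝓝 ((sphereInv ∘ Ψ) s)) = 𝓝 (Ψ s) := by
      have h2 := sphereInvHomeomorph.map_nhds_eq ((sphereInv ∘ Ψ) s)
      have h3 : sphereInvHomeomorph ((sphereInv ∘ Ψ) s) = Ψ s := sphereInv_sphereInv _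
      rw [h3] at h2
      exact h2
    rw [h1, map_map, ← Function.comp_assoc,
      show sphereInv ∘ sphereInv = id from funext sphereInv_sphereInv, Function.id_comp] at h
    exact h
  · exact nhds_le_map_of_ne_infty hΨ hc hs

theorem surjective_of_mdifferentiable [CompactSpace S] (hΨ : MDifferentiable 𝓘(ℂ) 𝓘(ℂ) Ψ)
    (hc : ¬ ∃ c, ∀ x, Ψ x = c) : Function.Surjective Ψ := by
  rw [← Set.range_eq_univ]
  exact IsClopen.eq_univ ⟨(isCompact_range hΨ.continuous).isClosed,
    (isOpenMap_of_mdifferentiable hΨ hc).isOpen_range⟩ (Set.range_nonempty Ψ)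

/-- A function `f` with `f ∘ ψ` holomorphic is holomorphic at the images of the points where `ψ`
is holomorphic and not critical. -/
theorem differentiableAt_of_comp {f ψ : ℂ → ℂ} {z : ℂ} (hψ : AnalyticAt ℂ ψ z)
    (hd : deriv ψ z ≠ 0) (hf : DifferentiableAt ℂ (f ∘ ψ) z) : DifferentiableAt ℂ f (ψ z) := by
  have hs := hψ.hasStrictDerivAt
  set σ := hs.localInverse ψ (deriv ψ z) z hd
  have h1 : σ (ψ z) = z := (hs.eventually_left_inverse hd).self_of_nhds
  have h2 : DifferentiableAt ℂ σ (ψ z) := (hs.to_localInverse hd).hasDerivAt.differentiableAt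
  have h3 : DifferentiableAt ℂ ((f ∘ ψ) ∘ σ) (ψ z) := DifferentiableAt.comp _ (h1.symm ▸ hf) h2
  refine h3.congr_of_eventuallyEq ?_
  filter_upwards [hs.eventually_right_inverse hd] with w hw
  exact congrArg f hw.symm

theorem eventually_deriv_ne_zero {ψ : ℂ → ℂ} {z : ℂ} (hψ : AnalyticAt ℂ ψ z)
    (hc : ¬ ∀ᶠ w in 𝓝[≠] z, ψ w = ψ z) : ∀ᶠ w in 𝓝[≠] z, deriv ψ w ≠ 0 := by
  refine hψ.deriv.eventually_eq_zero_or_eventually_ne_zero.resolve_left fun h => hc ?_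
  obtain ⟨r, hr, hball⟩ := Metric.eventually_nhds_iff_ball.1 (h.and hψ.eventually_analyticAt)
  refine nhdsWithin_le_nhds (eventually_of_mem (Metric.ball_mem_nhds z hr) fun w hw => ?_)
  exact Metric.isOpen_ball.is_const_of_deriv_eq_zero (convex_ball z r).isPreconnected
    (fun w hw => (hball w hw).2.differentiableAt.differentiableWithinAt)
    (fun w hw => (hball w hw).1) hw (Metric.mem_ball_self hr)

/-- Off the critical points `Ψ` has local holomorphic inverses, so `R` is holomorphic on a punctured
neighbourhood of `Ψ s`; continuity makes the singularity removable. -/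
theorem mdifferentiableAt_of_comp_of_ne_infty {R : RiemannSphere → RiemannSphere}
    (hΨ : MDifferentiable 𝓘(ℂ) 𝓘(ℂ) Ψ) (hc : ¬ ∃ c, ∀ x, Ψ x = c) (hR : Continuous R)
    (hRΨ : MDifferentiable 𝓘(ℂ) 𝓘(ℂ) (R ∘ Ψ)) {s : S} (hs : Ψ s ≠ OnePoint.infty)
    (hRs : R (Ψ s) ≠ OnePoint.infty) : MDifferentiableAt 𝓘(ℂ) 𝓘(ℂ) R (Ψ s) := by
  set f : ℂ → ℂ := fun w => coord (R (w : RiemannSphere)) with hf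
  set e := chartAt ℂ s
  set ψ : ℂ → ℂ := coord ∘ Ψ ∘ e.symm
  have hψ : AnalyticAt ℂ ψ (e s) :=
    (contMDiffAt_iff_analyticAt.1 (contMDiffAt_coord_comp hΨ hs)).2
  have hu : AnalyticAt ℂ ((coord ∘ (R ∘ Ψ)) ∘ e.symm) (e s) :=
    (contMDiffAt_iff_analyticAt.1 (contMDiffAt_coord_comp hRΨ hRs)).2
  have hψs : ψ (e s) = coord (Ψ s) := by
    simp [ψ, e, (chartAt ℂ s).left_inv (mem_chart_source ℂ s)]
  have hfψ : ∀ᶠ z in 𝓝 (e s), (f ∘ ψ) z = ((coord ∘ (R ∘ Ψ)) ∘ e.symm) z := by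
    filter_upwards [eventually_nhds_chartAt_iff.2 ((hΨ s).continuousAt.eventually_ne hs)] with z hz
    simp only [f, ψ, Function.comp_apply]
    rw [coe_coord hz]
  have hd : ∀ᶠ z in 𝓝[≠] (e s), DifferentiableAt ℂ f (ψ z) := by
    filter_upwards [eventually_deriv_ne_zero hψ (not_eventually_coord_comp_chart_eq hΨ hc _),
      nhdsWithin_le_nhds hψ.eventually_analyticAt, nhdsWithin_le_nhds hu.eventually_analyticAt,
      nhdsWithin_le_nhds hfψ.eventually_nhds] with z h1 h2 h3 h4
    exact differentiableAt_of_comp h2 h1 (h3.differentiableAt.congr_of_eventuallyEq h4)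
  have hpunct : ∀ᶠ w in 𝓝[≠] (coord (Ψ s)), DifferentiableAt ℂ f w := by
    rw [eventually_nhdsWithin_iff]
    -- Openness: every value near `Ψ s` is taken near `s`, and values other than `Ψ s` are taken at
    -- points other than `s`.
    refine nhds_le_map_chart hΨ hc hs ?_
    rw [eventually_nhdsWithin_iff] at hd
    change ∀ᶠ z in 𝓝 (e s), ψ z ≠ coord (Ψ s) → DifferentiableAt ℂ f (ψ z)
    filter_upwards [hd] with z hz hne
    exact hz fun h => hne (by rw [Set.mem_singleton_iff.1 h, hψs])
  have hcont : ContinuousAt f (coord (Ψ s)) := by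
    have h1 : ContinuousAt (fun w : ℂ => R (w : RiemannSphere)) (coord (Ψ s)) :=
      (hR.comp OnePoint.continuous_coe).continuousAt
    refine ContinuousAt.comp (g := coord) ?_ h1
    rw [coe_coord hs]
    exact (mdifferentiableAt_coord hRs).continuousAt
  have hdiff := (Complex.analyticAt_of_differentiable_on_punctured_nhds_of_continuousAt
    hpunct hcont).differentiableAt.mdifferentiableAt
  have h1 := (mdifferentiable_coe _).comp (Ψ s) (hdiff.comp (Ψ s) (mdifferentiableAt_coord hs))
  refine h1.congr_of_eventuallyEq ?_
  filter_upwards [isOpen_ne_infty.mem_nhds hs, hR.continuousAt.eventually_ne hRs] with p hp hRp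
  simp only [Function.comp_apply, f]
  rw [coe_coord hp, coe_coord hRp]

/-- A continuous self-map of the sphere whose composition with a nonconstant holomorphic map is
holomorphic is itself holomorphic. -/
theorem mdifferentiableAt_of_comp {R : RiemannSphere → RiemannSphere}
    (hΨ : MDifferentiable 𝓘(ℂ) 𝓘(ℂ) Ψ) (hc : ¬ ∃ c, ∀ x, Ψ x = c) (hR : Continuous R)
    (hRΨ : MDifferentiable 𝓘(ℂ) 𝓘(ℂ) (R ∘ Ψ)) (s : S) :
    MDifferentiableAt 𝓘(ℂ) 𝓘(ℂ) R (Ψ s) := by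
  have key : ∀ {R : RiemannSphere → RiemannSphere}, Continuous R →
      MDifferentiable 𝓘(ℂ) 𝓘(ℂ) (R ∘ Ψ) → R (Ψ s) ≠ OnePoint.infty →
      MDifferentiableAt 𝓘(ℂ) 𝓘(ℂ) R (Ψ s) := by
    intro R hR hRΨ hRs
    -- Inverting the source sphere, and below the target sphere, reduces everything to finite
    -- values.
    by_cases hs : Ψ s = OnePoint.infty
    · have h1 : (R ∘ sphereInv) ∘ (sphereInv ∘ Ψ) = R ∘ Ψ := by
        funext x
        simp [sphereInv_sphereInv]
      have h2 := mdifferentiableAt_of_comp_of_ne_infty (mdifferentiable_sphereInv.comp hΨ)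
        (not_const_sphereInv_comp hc) (hR.comp continuous_sphereInv) (h1 ▸ hRΨ) (s := s)
        (by simp [hs]) (by simpa [sphereInv_sphereInv] using hRs)
      have h3 := MDifferentiableAt.comp (Ψ s) h2 (mdifferentiable_sphereInv (Ψ s))
      refine h3.congr_of_eventuallyEq (Eventually.of_forall fun p => ?_)
      simp [sphereInv_sphereInv]
    · exact mdifferentiableAt_of_comp_of_ne_infty hΨ hc hR hRΨ hs hRs
  by_cases hRs : R (Ψ s) = OnePoint.infty
  · have h1 := key (R := sphereInv ∘ R) (continuous_sphereInv.comp hR)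
      (mdifferentiable_sphereInv.comp hRΨ) (by simp [hRs])
    have h2 := (mdifferentiable_sphereInv _).comp (Ψ s) h1
    refine h2.congr_of_eventuallyEq (Eventually.of_forall fun p => ?_)
    simp [sphereInv_sphereInv]
  · exact key hR hRΨ hRs

/-- A holomorphic map that is constant on the fibres of `Ψ` is a rational function in `Ψ`. -/
theorem isRationalIn_of_factors [CompactSpace S] {U : S → RiemannSphere}
    (hΨ : MDifferentiable 𝓘(ℂ) 𝓘(ℂ) Ψ) (hc : ¬ ∃ c, ∀ x, Ψ x = c)
    (hU : MDifferentiable 𝓘(ℂ) 𝓘(ℂ) U) (h : ∀ x y, Ψ x = Ψ y → U x = U y) :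
    IsRationalIn U Ψ := by
  have hsurj := surjective_of_mdifferentiable hΨ hc
  set R : RiemannSphere → RiemannSphere := U ∘ Function.surjInv hsurj
  have hRΨ : R ∘ Ψ = U := funext fun x => h _ _ (Function.surjInv_eq hsurj (Ψ x))
  -- An open continuous surjection is a quotient map, so `R` is continuous although it is defined
  -- through arbitrary choices of preimages.
  have hq := (isOpenMap_of_mdifferentiable hΨ hc).isQuotientMap hΨ.continuous hsurj
  have hRcont : Continuous R := by
    rw [hq.continuous_iff, hRΨ]
    exact hU.continuous
  have hR : MDifferentiable 𝓘(ℂ) 𝓘(ℂ) R := by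
    intro p
    obtain ⟨s, rfl⟩ := hsurj p
    exact mdifferentiableAt_of_comp hΨ hc hRcont (hRΨ.symm ▸ hU) s
  by_cases hRc : ∃ c, ∀ p, R p = c
  · obtain ⟨c, hRc⟩ := hRc
    induction c using OnePoint.rec with
    | infty => exact Or.inr (hRΨ ▸ funext fun x => hRc (Ψ x))
    | coe z =>
      refine Or.inl ⟨RatFunc.C z, ?_⟩
      rw [← hRΨ]
      funext x
      rw [Function.comp_apply, Function.comp_apply, hRc, ratMap_C]
  · obtain ⟨T, hT⟩ := exists_eq_ratMap_of_mdifferentiable hR hRc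
    exact Or.inl ⟨T, by rw [← hT, hRΨ]⟩

end Descent

end TameRational

end

/-! ### The theorem: an automorphism over `Ψ` that moves `U` -/

open TameRational
theorem mainTheorem9 (A : RatFunc ℂ) (hA : 2 ≤ ratDegree A)
    (S : Type*) [TopologicalSpace S] [T2Space S] [CompactSpace S] [ConnectedSpace S]
    [ChartedSpace ℂ S] [IsManifold 𝓘(ℂ) ω S]
    (hS : surfaceGenus S = 0 ∨ surfaceGenus S = 1)
    (U Ψ : S → RiemannSphere) (hU : MDifferentiable 𝓘(ℂ) 𝓘(ℂ) U) (hΨ : IsGaloisCovering Ψ)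
    (hAU : IsRationalIn (ratMap A ∘ U) Ψ) (hnot : ¬ IsRationalIn U Ψ) :
    IsWild A := by
  obtain ⟨σ, hσ, hσU⟩ : ∃ σ : S ≃ₘ^ω⟮𝓘(ℂ), 𝓘(ℂ)⟯ S, Ψ ∘ σ = Ψ ∧ U ∘ σ ≠ U := by
    -- If all automorphisms over `Ψ` fixed `U`, transitivity would make `U` constant on the fibres
    -- and hence rational in `Ψ`.
    by_contra! h
    refine hnot (isRationalIn_of_factors hΨ.holomorphic hΨ.nonconstant hU fun x y hxy => ?_)
    obtain ⟨σ, hσ, rfl⟩ := hΨ.transitive x y hxy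
    exact (congrFun (h σ hσ) x).symm
  have hUc : ¬ ∃ c, ∀ x, U x = c := by
    rintro ⟨c, hc⟩
    exact hσU (funext fun x => by rw [Function.comp_apply, hc, hc])
  have hVc : ¬ ∃ c, ∀ x, (U ∘ σ) x = c := by
    rintro ⟨c, hc⟩
    refine hUc ⟨c, fun x => ?_⟩
    have := hc (σ.symm x)
    rwa [Function.comp_apply, σ.apply_symm_apply] at this
  have hV : MDifferentiable 𝓘(ℂ) 𝓘(ℂ) (U ∘ σ) := hU.comp (σ.mdifferentiable (by simp))
  have hAσ : ∀ f : S → RiemannSphere, IsRationalIn f Ψ → f ∘ σ = f := by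
    rintro f (⟨R, rfl⟩ | rfl)
    · rw [Function.comp_assoc, hσ]
    · rfl
  -- A function rational in `Ψ` is invariant under `σ`, so `A ∘ U = A ∘ U ∘ σ`.
  exact isWild_of_ratMap_comp_eq hA hS hU hV hUc hVc hσU.symm (hAσ _ hAU).symm
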